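/- Let $\mathbb{N}=\{1,2,\dots\}$. The Schreier families of finite subsets of $\mathbb{N}$ are $\mathcal{S}_0=\{\emptyset\}\cup\{\{k\}:k\in\mathbb{N}\}$, $\mathcal{S}_1=\{\emptyset\}\cup\{A:|A|\le\min A\}$ and, for $n\ge1$, $\mathcal{S}_{n+1}=\mathcal{S}_1[\mathcal{S}_n]$, the family of all unions $G_1\cup\dots\cup G_k$ of successive nonempty sets $G_1<\dots<G_k$ in $\mathcal{S}_n$ with $\{\min G_1,\dots,\min G_k\}\in\mathcal{S}_1$. Let $(\theta_n)_{n\ge1}$ be a null sequence in $(0,1)$ and let $\sigma_n\in\{U,M\}$ for $n\ge1$, with $\sigma_{p_0}=M$ for some $p_0$. A finite family $(E_i)_{i=1}^k$ of nonempty subsets of $\mathbb{N}$ is called $(\mathcal{S}_n,\sigma_n)$-adapted if $\{\min E_1,\dots,\min E_k\}\in\mathcal{S}_n$ and the sets $E_i$ are pairwise disjoint (if $\sigma_n=M$), respectively $E_1<\dots<E_k$ (if $\sigma_n=U$). The partly modified mixed Tsirelson space $X=T[(\mathcal{S}_n,\sigma_n,\theta_n)_{n=1}^\infty]$ is the completion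 of the space $c_{00}$ of finitely supported real sequences under the norm implicitly defined by $$\|x\|=\max\Big\{\|x\|_{c_0},\ \sup_n\theta_n\sup\sum_i\|E_ix\|\Big\},$$ where the last supremum is over all $(\mathcal{S}_n,\sigma_n)$-adapted families $(E_i)$ and $E_ix$ is the restriction of $x$ to $E_i$; equivalently $\|x\|=\lim_j\|x\|_j$, where $\|x\|_0=\|x\|_{c_0}$ and $\|x\|_{j+1}$ is the right-hand side computed with $\|\cdot\|_j$. For $m,n\in\mathbb{N}$ put $$\eta_{m,n}=\inf\frac{\theta_{m+n}}{\theta_{n_1}\cdots\theta_{n_s}},$$ the infimum being over all finite sequences $n_1,\dots,n_s$ in $\mathbb{N}$ with $n_1+\dots+n_s\ge n$, with the additional requirement $\sigma_{n_1}=\dots=\sigma_{n_s}=M$ if $\sigma_{m+n}=M$. For a Banach space $B$ and $1\le K<\infty$, an $\ell^1$-$K$-tree in $B$ is a set $\mathcal{T}\subseteq\bigcup_{n\ge1}B^n$ that contains $(x_1,\dots,x_n)$ whenever it contains $(x_1,\dots,x_{n+1})$, $n\ge 1$, and all of whose elements $(x_1,\dots,x_n)$ satisfy $\|x_k\|=1$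 for all $k$ and $\|\sum a_kx_k\|\ge K^{-1}\sum|a_k|$ for all scalars $(a_k)$. Let $\mathcal{D}^{(0)}(\mathcal{T})=\mathcal{T}$, let $\mathcal{D}^{(\alpha+1)}(\mathcal{T})$ consist of all $(x_1,\dots,x_n)$, $n\ge 1$, such that $(x_1,\dots,x_n,x)\in\mathcal{D}^{(\alpha)}(\mathcal{T})$ for some $x$, and let $\mathcal{D}^{(\alpha)}(\mathcal{T})=\bigcap_{\beta<\alpha}\mathcal{D}^{(\beta)}(\mathcal{T})$ for limit ordinals $\alpha$; the order $o(\mathcal{T})$ of a well-founded tree is the least $\alpha$ with $\mathcal{D}^{(\alpha)}(\mathcal{T})=\emptyset$. If $B$ does not contain an isomorphic copy of $\ell^1$ (so that all its $\ell^1$-$K$-trees are well-founded), its Bourgain $\ell^1$-index is $I(B)=\sup_{1\le K<\infty}\sup\{o(\mathcal{T}):\mathcal{T}\text{ is an }\ell^1\text{-}K\text{-tree in }B\}$. **Theorem.** If $\inf_m\limsup_n\eta_{m,n}=0$, then $X$ does not contain an isomorphic copy of $\ell^1$ and its Bourgain $\ell^1$-index is $I(X)=\omega^\omega$. -/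

import Mathlib

open Set Filter Topology
open scoped Ordinal

universe u

/-! ### Finite subsets of the positive integers and the Schreier families -/

/-- `F[G]`: unions `G₁ ∪ ⋯ ∪ G_k` of successive nonempty members of `G` (`m i` is the minimum of
the `i`-th one) such that the set of minima belongs to `F`. -/
def familyBracket (F G : Set (Finset ℕ+)) : Set (Finset ℕ+) :=
  {A | ∃ (k : ℕ) (H : Fin k → Finset ℕ+) (m : Fin k → ℕ+),
      (∀ i, H i ∈ G) ∧
      (∀ i, IsLeast (H i : Set ℕ+) (m i)) ∧
      (∀ i j, i < j → ∀ a ∈ H i, ∀ b ∈ H j, a < b) ∧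
      Finset.univ.image m ∈ F ∧
      A = Finset.univ.biUnion H}

/-- The empty set and all `A` with `|A| ≤ min A`. -/
def schreierOne : Set (Finset ℕ+) :=
  {A | ∀ a ∈ A, A.card ≤ (a : ℕ)}

/-- The Schreier families of finite order: singletons and the empty set for `n = 0`, and
`S_{n+1} = S₁[S_n]`. For `n = 0` the recursion gives `S₁` back, see `schreier_one`. -/
def schreier : ℕ → Set (Finset ℕ+)
  | 0 => {A | A.card ≤ 1}
  | n + 1 => familyBracket schreierOne (schreier n)

theorem schreier_one : schreier 1 = schreierOne := by
  ext A
  constructor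
  · rintro ⟨k, H, m, hH, hm, hlt, hmem, rfl⟩
    have h1 : ∀ i, H i = {m i} := by
      intro i
      have hc : (H i).card ≤ 1 := hH i
      ext a
      rw [Finset.mem_singleton]
      exact ⟨fun ha => Finset.card_le_one.mp hc a ha (m i) (hm i).1,
        fun ha => ha ▸ (hm i).1⟩
    have h2 : Finset.univ.biUnion H = Finset.univ.image m := by
      ext a
      simp [h1, eq_comm]
    rw [h2]
    exact hmem
  · intro hA
    have key : ∀ a, (∃ i, A.orderEmbOfFin rfl i = a) ↔ a ∈ A := by
      intro a
      rw [← Set.mem_range, Finset.range_orderEmbOfFin, Finset.mem_coe]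
    refine ⟨A.card, fun i => {A.orderEmbOfFin rfl i}, fun i => A.orderEmbOfFin rfl i,
      fun i => by simp [schreier], fun i => by simp, ?_, ?_, ?_⟩
    · intro i j hij a ha b hb
      rw [Finset.mem_singleton] at ha hb
      subst ha hb
      exact (A.orderEmbOfFin rfl).lt_iff_lt.mpr hij
    · have h3 : Finset.univ.image (fun i => A.orderEmbOfFin rfl i) = A := by
        ext a
        simp
      rw [h3]
      exact hA
    · ext a
      simpa [eq_comm] using (key a).symm

/-! ### Partly modified mixed Tsirelson spaces -/

/-- The two modes: `U` (unmodified) and `M` (modified). -/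
inductive TsirelsonMode
  | U
  | M

/-- The parameters of a partly modified mixed Tsirelson space: a null sequence `θ` in `(0,1)` and
a sequence of modes, at least one of which is `M`. -/
structure TsirelsonData where
  θ : ℕ+ → ℝ
  σ : ℕ+ → TsirelsonMode
  θ_mem : ∀ n, θ n ∈ Ioo (0 : ℝ) 1
  θ_null : Tendsto θ atTop (𝓝 0)
  exists_modified : ∃ p, σ p = TsirelsonMode.M

/-- Pairwise disjoint sets in the mode `M`, successive sets in the mode `U`. -/
def SeparatedFamily (s : TsirelsonMode) {k : ℕ} (E : Fin k → Set ℕ+) : Prop :=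
  match s with
  | TsirelsonMode.M => ∀ i j, i ≠ j → Disjoint (E i) (E j)
  | TsirelsonMode.U => ∀ i j, i < j → ∀ a ∈ E i, ∀ b ∈ E j, a < b

/-- The finite family `E` of nonempty subsets of the positive integers is `(S_n, s)`-adapted. -/
def AdaptedFamily (n : ℕ+) (s : TsirelsonMode) {k : ℕ} (E : Fin k → Set ℕ+) : Prop :=
  (∃ m : Fin k → ℕ+, (∀ i, IsLeast (E i) (m i)) ∧ Finset.univ.image m ∈ schreier n) ∧
    SeparatedFamily s E

open Classical in
/-- The restriction `Ex` of a finitely supported sequence `x` to the coordinates in `E`. -/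
noncomputable def restrictTo (E : Set ℕ+) (x : ℕ+ →₀ ℝ) : ℕ+ →₀ ℝ :=
  x.filter (fun k => k ∈ E)

/-- The `c₀`-norm of a finitely supported sequence. -/
noncomputable def czeroNorm (x : ℕ+ →₀ ℝ) : ℝ := ⨆ k, |x k|

/-- The `ℓ¹`-norm of a finitely supported sequence. -/
noncomputable def loneNorm (x : ℕ+ →₀ ℝ) : ℝ := ∑ k ∈ x.support, |x k|

namespace TsirelsonData

/-- The set of numbers `θ_n ∑ᵢ N (Eᵢ x)` over all `n` and all `(S_n, σ_n)`-adapted `(Eᵢ)`. -/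
def adaptedSums (D : TsirelsonData) (N : (ℕ+ →₀ ℝ) → ℝ) (x : ℕ+ →₀ ℝ) : Set ℝ :=
  {r | ∃ (n : ℕ+) (k : ℕ) (E : Fin k → Set ℕ+),
      AdaptedFamily n (D.σ n) E ∧ r = D.θ n * ∑ i, N (restrictTo (E i) x)}

/-- The right-hand side of the implicit equation of the norm. -/
noncomputable def normStep (D : TsirelsonData) (N : (ℕ+ →₀ ℝ) → ℝ) (x : ℕ+ →₀ ℝ) : ℝ :=
  max (czeroNorm x) (sSup (D.adaptedSums N x))

/-- The iterated norms, starting from the `c₀`-norm. -/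
noncomputable def iterNorm (D : TsirelsonData) : ℕ → (ℕ+ →₀ ℝ) → ℝ
  | 0 => czeroNorm
  | i + 1 => D.normStep (D.iterNorm i)

/-- The norm of the partly modified mixed Tsirelson space on finitely supported sequences, as the
limit of the (increasing) iterated norms. It solves the implicit equation of the norm, see
`tnorm_eq`. -/
noncomputable def tnorm (D : TsirelsonData) (x : ℕ+ →₀ ℝ) : ℝ := ⨆ i, D.iterNorm i x

end TsirelsonData

theorem abs_le_loneNorm (x : ℕ+ →₀ ℝ) (k : ℕ+) : |x k| ≤ loneNorm x := by
  by_cases hk : k ∈ x.support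
  · exact Finset.single_le_sum (f := fun k => |x k|) (fun _ _ => abs_nonneg _) hk
  · rw [Finsupp.notMem_support_iff.mp hk, abs_zero]
    exact Finset.sum_nonneg fun _ _ => abs_nonneg _

theorem abs_le_czeroNorm (x : ℕ+ →₀ ℝ) (k : ℕ+) : |x k| ≤ czeroNorm x :=
  le_ciSup (f := fun k => |x k|) ⟨loneNorm x, by rintro _ ⟨j, rfl⟩; exact abs_le_loneNorm x j⟩ k

theorem sum_loneNorm_restrictTo_le {k : ℕ} (E : Fin k → Set ℕ+)
    (hE : ∀ i j, i ≠ j → Disjoint (E i) (E j)) (x : ℕ+ →₀ ℝ) :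
    ∑ i, loneNorm (restrictTo (E i) x) ≤ loneNorm x := by
  classical
  have h1 : ∀ i, loneNorm (restrictTo (E i) x) =
      ∑ l ∈ x.support, if l ∈ E i then |x l| else 0 := by
    intro i
    unfold loneNorm restrictTo
    rw [Finsupp.support_filter, Finset.sum_filter]
    refine Finset.sum_congr rfl fun l _ => ?_
    split_ifs with h
    · rw [Finsupp.filter_apply_pos _ _ h]
    · rfl
  simp_rw [h1]
  rw [Finset.sum_comm]
  refine Finset.sum_le_sum fun l _ => ?_
  by_cases h : ∃ i, l ∈ E i
  · obtain ⟨i, hi⟩ := h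
    rw [Finset.sum_eq_single i]
    · rw [if_pos hi]
    · intro j _ hj
      rw [if_neg]
      intro hlj
      exact Set.disjoint_left.mp (hE j i hj) hlj hi
    · intro h; exact absurd (Finset.mem_univ i) h
  · rw [Finset.sum_eq_zero]
    · exact abs_nonneg _
    · intro i _
      rw [if_neg]
      exact fun hi => h ⟨i, hi⟩

theorem AdaptedFamily.disjoint {n : ℕ+} {s : TsirelsonMode} {k : ℕ} {E : Fin k → Set ℕ+}
    (h : AdaptedFamily n s E) : ∀ i j, i ≠ j → Disjoint (E i) (E j) := by
  have h2 := h.2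
  cases s with
  | M => exact h2
  | U =>
    intro i j hij
    rw [Set.disjoint_left]
    intro a hi hj
    rcases lt_or_gt_of_ne hij with h' | h'
    · exact lt_irrefl a (h2 i j h' a hi a hj)
    · exact lt_irrefl a (h2 j i h' a hj a hi)

theorem restrictTo_add (E : Set ℕ+) (x y : ℕ+ →₀ ℝ) :
    restrictTo E (x + y) = restrictTo E x + restrictTo E y := by
  classical exact Finsupp.filter_add

theorem restrictTo_smul (E : Set ℕ+) (c : ℝ) (x : ℕ+ →₀ ℝ) :
    restrictTo E (c • x) = c • restrictTo E x := by
  classical exact Finsupp.filter_smul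

/-- A seminorm between the `c₀`-norm and the `ℓ¹`-norm. -/
structure IsIntermediateNorm (N : (ℕ+ →₀ ℝ) → ℝ) : Prop where
  czero_le : ∀ x, czeroNorm x ≤ N x
  le_lone : ∀ x, N x ≤ loneNorm x
  add_le : ∀ x y, N (x + y) ≤ N x + N y
  smul_le : ∀ (c : ℝ) x, N (c • x) ≤ |c| * N x

theorem czeroNorm_nonneg (x : ℕ+ →₀ ℝ) : 0 ≤ czeroNorm x :=
  (abs_nonneg _).trans (abs_le_czeroNorm x 1)

theorem IsIntermediateNorm.nonneg {N : (ℕ+ →₀ ℝ) → ℝ} (h : IsIntermediateNorm N)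
    (x : ℕ+ →₀ ℝ) : 0 ≤ N x := (czeroNorm_nonneg x).trans (h.czero_le x)

theorem isIntermediateNorm_czeroNorm : IsIntermediateNorm czeroNorm where
  czero_le _ := le_rfl
  le_lone x := ciSup_le (abs_le_loneNorm x)
  add_le x y := ciSup_le fun k =>
    (abs_add_le (x k) (y k)).trans (add_le_add (abs_le_czeroNorm x k) (abs_le_czeroNorm y k))
  smul_le c x := ciSup_le fun k => by
    rw [Finsupp.smul_apply, smul_eq_mul, abs_mul]
    exact mul_le_mul_of_nonneg_left (abs_le_czeroNorm x k) (abs_nonneg c)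

namespace TsirelsonData

variable (D : TsirelsonData)

theorem adaptedSums_le {N : (ℕ+ →₀ ℝ) → ℝ} (hN : IsIntermediateNorm N) (x : ℕ+ →₀ ℝ) :
    ∀ r ∈ D.adaptedSums N x, r ≤ loneNorm x := by
  rintro r ⟨n, k, E, hE, rfl⟩
  have h1 : ∑ i, N (restrictTo (E i) x) ≤ loneNorm x :=
    (Finset.sum_le_sum fun i _ => hN.le_lone _).trans
      (sum_loneNorm_restrictTo_le E hE.disjoint x)
  have h0 : 0 ≤ ∑ i, N (restrictTo (E i) x) := Finset.sum_nonneg fun i _ => hN.nonneg _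
  have := D.θ_mem n
  exact (mul_le_of_le_one_left h0 this.2.le).trans h1

theorem bddAbove_adaptedSums {N : (ℕ+ →₀ ℝ) → ℝ} (hN : IsIntermediateNorm N) (x : ℕ+ →₀ ℝ) :
    BddAbove (D.adaptedSums N x) := ⟨_, D.adaptedSums_le hN x⟩

theorem sum_le_normStep {N : (ℕ+ →₀ ℝ) → ℝ} (hN : IsIntermediateNorm N) (x : ℕ+ →₀ ℝ)
    {n : ℕ+} {k : ℕ} {E : Fin k → Set ℕ+} (hE : AdaptedFamily n (D.σ n) E) :
    D.θ n * ∑ i, N (restrictTo (E i) x) ≤ D.normStep N x :=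
  (le_csSup (D.bddAbove_adaptedSums hN x) ⟨n, k, E, hE, rfl⟩).trans (le_max_right _ _)

theorem normStep_le {N : (ℕ+ →₀ ℝ) → ℝ} {x : ℕ+ →₀ ℝ} {b : ℝ}
    (h0 : czeroNorm x ≤ b)
    (h : ∀ (n : ℕ+) (k : ℕ) (E : Fin k → Set ℕ+), AdaptedFamily n (D.σ n) E →
      D.θ n * ∑ i, N (restrictTo (E i) x) ≤ b) : D.normStep N x ≤ b := by
  refine max_le h0 (Real.sSup_le ?_ ((czeroNorm_nonneg x).trans h0))
  rintro r ⟨n, k, E, hE, rfl⟩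
  exact h n k E hE

theorem isIntermediateNorm_normStep {N : (ℕ+ →₀ ℝ) → ℝ} (hN : IsIntermediateNorm N) :
    IsIntermediateNorm (D.normStep N) where
  czero_le x := le_max_left _ _
  le_lone x := D.normStep_le (isIntermediateNorm_czeroNorm.le_lone x)
    fun n k E hE => D.adaptedSums_le hN x _ ⟨n, k, E, hE, rfl⟩
  add_le x y := by
    refine D.normStep_le ((isIntermediateNorm_czeroNorm.add_le x y).trans
      (add_le_add (le_max_left _ _) (le_max_left _ _))) fun n k E hE => ?_
    refine le_trans ?_ (add_le_add (D.sum_le_normStep hN x hE) (D.sum_le_normStep hN y hE))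
    rw [← mul_add, ← Finset.sum_add_distrib]
    refine mul_le_mul_of_nonneg_left (Finset.sum_le_sum fun i _ => ?_) (D.θ_mem n).1.le
    rw [restrictTo_add]
    exact hN.add_le _ _
  smul_le c x := by
    refine D.normStep_le ((isIntermediateNorm_czeroNorm.smul_le c x).trans
      (mul_le_mul_of_nonneg_left (le_max_left _ _) (abs_nonneg c))) fun n k E hE => ?_
    refine le_trans ?_ (mul_le_mul_of_nonneg_left (D.sum_le_normStep hN x hE) (abs_nonneg c))
    rw [mul_left_comm]
    refine mul_le_mul_of_nonneg_left ?_ (D.θ_mem n).1.le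
    rw [Finset.mul_sum]
    refine Finset.sum_le_sum fun i _ => ?_
    rw [restrictTo_smul]
    exact hN.smul_le _ _

theorem isIntermediateNorm_iterNorm (i : ℕ) : IsIntermediateNorm (D.iterNorm i) := by
  induction i with
  | zero => exact isIntermediateNorm_czeroNorm
  | succ i ih => exact D.isIntermediateNorm_normStep ih

theorem normStep_mono {N N' : (ℕ+ →₀ ℝ) → ℝ} (hN' : IsIntermediateNorm N')
    (h : ∀ x, N x ≤ N' x) (x : ℕ+ →₀ ℝ) : D.normStep N x ≤ D.normStep N' x :=
  D.normStep_le (le_max_left _ _) fun n _ _ hE =>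
    (mul_le_mul_of_nonneg_left (Finset.sum_le_sum fun _ _ => h _) (D.θ_mem n).1.le).trans
      (D.sum_le_normStep hN' x hE)

theorem iterNorm_mono (x : ℕ+ →₀ ℝ) : Monotone fun i => D.iterNorm i x := by
  have h : ∀ i x, D.iterNorm i x ≤ D.iterNorm (i + 1) x := by
    intro i
    induction i with
    | zero => exact fun x => le_max_left _ _
    | succ i ih => exact D.normStep_mono (D.isIntermediateNorm_iterNorm (i + 1)) ih
  exact monotone_nat_of_le_succ fun i => h i x

theorem bddAbove_iterNorm (x : ℕ+ →₀ ℝ) : BddAbove (Set.range fun i => D.iterNorm i x) :=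
  ⟨loneNorm x, by rintro _ ⟨i, rfl⟩; exact (D.isIntermediateNorm_iterNorm i).le_lone x⟩

theorem iterNorm_le_tnorm (i : ℕ) (x : ℕ+ →₀ ℝ) : D.iterNorm i x ≤ D.tnorm x :=
  le_ciSup (D.bddAbove_iterNorm x) i

theorem isIntermediateNorm_tnorm : IsIntermediateNorm D.tnorm where
  czero_le x := D.iterNorm_le_tnorm 0 x
  le_lone x := ciSup_le fun i => (D.isIntermediateNorm_iterNorm i).le_lone x
  add_le x y := ciSup_le fun i => ((D.isIntermediateNorm_iterNorm i).add_le x y).trans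
    (add_le_add (D.iterNorm_le_tnorm i x) (D.iterNorm_le_tnorm i y))
  smul_le c x := ciSup_le fun i => ((D.isIntermediateNorm_iterNorm i).smul_le c x).trans
    (mul_le_mul_of_nonneg_left (D.iterNorm_le_tnorm i x) (abs_nonneg c))

/-- The implicit equation of the norm. -/
theorem tnorm_eq (x : ℕ+ →₀ ℝ) :
    D.tnorm x = max (czeroNorm x) (sSup (D.adaptedSums D.tnorm x)) := by
  apply le_antisymm
  · refine ciSup_le fun i => ?_
    cases i with
    | zero => exact le_max_left _ _
    | succ i => exact D.normStep_mono D.isIntermediateNorm_tnorm (D.iterNorm_le_tnorm i) x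
  · refine D.normStep_le (D.isIntermediateNorm_tnorm.czero_le x) fun n k E hE => ?_
    have hlim : Tendsto (fun i => D.θ n * ∑ j, D.iterNorm i (restrictTo (E j) x)) atTop
        (𝓝 (D.θ n * ∑ j, D.tnorm (restrictTo (E j) x))) :=
      (tendsto_finsetSum _ fun j _ =>
        tendsto_atTop_ciSup (D.iterNorm_mono _) (D.bddAbove_iterNorm _)).const_mul _
    exact le_of_tendsto' hlim fun i =>
      (D.sum_le_normStep (D.isIntermediateNorm_iterNorm i) x hE).trans
        (D.iterNorm_le_tnorm (i + 1) x)

/-- The space `c₀₀` of finitely supported real sequences, with the norm `D.tnorm`. -/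
def FinSeq (_D : TsirelsonData) : Type := ℕ+ →₀ ℝ

noncomputable instance : AddCommGroup D.FinSeq := inferInstanceAs (AddCommGroup (ℕ+ →₀ ℝ))

noncomputable instance : Module ℝ D.FinSeq := inferInstanceAs (Module ℝ (ℕ+ →₀ ℝ))

noncomputable instance : Norm D.FinSeq := ⟨D.tnorm⟩

theorem finSeq_core : NormedSpace.Core ℝ D.FinSeq where
  norm_nonneg x := D.isIntermediateNorm_tnorm.nonneg x
  norm_smul c x := by
    refine le_antisymm (D.isIntermediateNorm_tnorm.smul_le c x) ?_
    change |c| * D.tnorm x ≤ D.tnorm (c • (show ℕ+ →₀ ℝ from x))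
    by_cases hc : c = 0
    · subst hc
      rw [abs_zero, zero_mul]
      exact D.isIntermediateNorm_tnorm.nonneg _
    · have h := D.isIntermediateNorm_tnorm.smul_le c⁻¹ (c • (show ℕ+ →₀ ℝ from x))
      rw [smul_smul, inv_mul_cancel₀ hc, one_smul, abs_inv] at h
      have hc' : 0 < |c| := abs_pos.mpr hc
      calc |c| * D.tnorm x
          ≤ |c| * (|c|⁻¹ * D.tnorm (c • (show ℕ+ →₀ ℝ from x))) :=
            mul_le_mul_of_nonneg_left h hc'.le
        _ = D.tnorm (c • (show ℕ+ →₀ ℝ from x)) := by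
            rw [← mul_assoc, mul_inv_cancel₀ hc'.ne', one_mul]
  norm_triangle x y := D.isIntermediateNorm_tnorm.add_le x y
  norm_eq_zero_iff x := by
    change D.tnorm x = 0 ↔ x = 0
    constructor
    · intro h
      refine Finsupp.ext (f := (show ℕ+ →₀ ℝ from x)) fun k => ?_
      have h1 := (abs_le_czeroNorm (show ℕ+ →₀ ℝ from x) k).trans
        (D.isIntermediateNorm_tnorm.czero_le x)
      rw [h] at h1
      exact abs_eq_zero.mp (le_antisymm h1 (abs_nonneg _))
    · intro h
      rw [h]
      refine le_antisymm ?_ (D.isIntermediateNorm_tnorm.nonneg _)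
      have h2 := D.isIntermediateNorm_tnorm.le_lone 0
      have h3 : loneNorm (0 : ℕ+ →₀ ℝ) = 0 := by simp [loneNorm]
      rw [h3] at h2
      exact h2

noncomputable instance : NormedAddCommGroup D.FinSeq := NormedAddCommGroup.ofCore D.finSeq_core

noncomputable instance : NormedSpace ℝ D.FinSeq := NormedSpace.ofCore D.finSeq_core

/-- The partly modified mixed Tsirelson space `T[(S_n, σ_n, θ_n)_{n ≥ 1}]`: the completion of
`c₀₀` under the norm `D.tnorm`. -/
abbrev Space : Type := UniformSpace.Completion D.FinSeq

/-- `η_{m,n}`: the infimum of `θ_{m+n} / (θ_{n₁} ⋯ θ_{n_s})` over all finite sequences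
`n₁, …, n_s` with `n₁ + ⋯ + n_s ≥ n`, where `σ_{n₁} = ⋯ = σ_{n_s} = M` is required if
`σ_{m+n} = M`. -/
noncomputable def eta (m n : ℕ+) : ℝ :=
  sInf {r | ∃ l : List ℕ+, (n : ℕ) ≤ (l.map fun j : ℕ+ => (j : ℕ)).sum ∧
    (D.σ (m + n) = TsirelsonMode.M → ∀ j ∈ l, D.σ j = TsirelsonMode.M) ∧
    r = D.θ (m + n) / (l.map D.θ).prod}

/-- All `η_{m,n}` lie in `[0,1]`, so that the real-valued `limsup` and infimum over them are the
usual ones. -/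
theorem eta_mem_Icc (m n : ℕ+) : D.eta m n ∈ Icc (0 : ℝ) 1 := by
  have h0 : ∀ r ∈ {r | ∃ l : List ℕ+, (n : ℕ) ≤ (l.map fun j : ℕ+ => (j : ℕ)).sum ∧
    (D.σ (m + n) = TsirelsonMode.M → ∀ j ∈ l, D.σ j = TsirelsonMode.M) ∧
    r = D.θ (m + n) / (l.map D.θ).prod}, (0 : ℝ) ≤ r := by
    rintro r ⟨l, -, -, rfl⟩
    refine div_nonneg (D.θ_mem _).1.le (List.prod_nonneg ?_)
    intro a ha
    obtain ⟨j, -, rfl⟩ := List.mem_map.mp ha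
    exact (D.θ_mem j).1.le
  refine ⟨Real.sInf_nonneg h0, csInf_le ⟨0, h0⟩ ⟨[m + n], by simp, by simp, ?_⟩⟩
  simp [(D.θ_mem (m + n)).1.ne']

end TsirelsonData

/-! ### Trees and the Bourgain `ℓ¹`-index -/

section Trees

variable {B : Type u}

/-- A tree on `B`: a set of nonempty finite sequences, closed under nonempty initial segments. -/
structure IsSeqTree (T : Set (List B)) : Prop where
  ne_nil : ∀ s ∈ T, s ≠ []
  of_append : ∀ (s : List B) (x : B), s ≠ [] → s ++ [x] ∈ T → s ∈ T

/-- The derived tree: the nodes that have a proper extension in the tree. -/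
def derivedTree (T : Set (List B)) : Set (List B) :=
  {s | s ≠ [] ∧ ∃ x : B, s ++ [x] ∈ T}

/-- The transfinite derivatives `D^(α)(T)`. -/
noncomputable def iterDerivedTree (T : Set (List B)) (α : Ordinal.{u}) : Set (List B) :=
  Ordinal.limitRecOn (motive := fun _ => Set (List B)) α T
    (fun _ S => derivedTree S)
    (fun β _ ih => ⋂ (γ : Ordinal.{u}) (h : γ < β), ih γ h)

/-- The order of a (well-founded) tree: the least `α` with `D^(α)(T) = ∅`. -/
noncomputable def treeOrder (T : Set (List B)) : Ordinal.{u} :=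
  sInf {α | iterDerivedTree T α = ∅}

end Trees

section Index

variable (B : Type u) [NormedAddCommGroup B] [NormedSpace ℝ B]

/-- `T` is an `ℓ¹`-`K`-tree in `B`: every node `(x₁, …, x_n)` is normalized and satisfies
`‖∑ a_k x_k‖ ≥ K⁻¹ ∑ |a_k|` for all scalars. -/
def IsEllOneTree (K : ℝ) (T : Set (List B)) : Prop :=
  IsSeqTree T ∧ ∀ s ∈ T, (∀ x ∈ s, ‖x‖ = 1) ∧
    ∀ a : Fin s.length → ℝ, K⁻¹ * ∑ i, |a i| ≤ ‖∑ i, a i • s.get i‖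

/-- `B` contains an isomorphic copy of `ℓ¹`. -/
def ContainsEllOne : Prop :=
  ∃ (f : lp (fun _ : ℕ => ℝ) 1 →L[ℝ] B) (c : ℝ), 0 < c ∧ ∀ x, c * ‖x‖ ≤ ‖f x‖

/-- `I(B, K)`: the supremum of the orders of the `ℓ¹`-`K`-trees in `B`. This is meant for spaces
that do not contain `ℓ¹`, in which every `ℓ¹`-`K`-tree is well-founded. -/
noncomputable def bourgainIndexAt (K : ℝ) : Ordinal.{u} :=
  sSup {o | ∃ T : Set (List B), IsEllOneTree B K T ∧ o = treeOrder T}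

/-- The Bourgain `ℓ¹`-index `I(B) = sup_{1 ≤ K < ∞} I(B, K)` of a space that does not contain
`ℓ¹`. -/
noncomputable def bourgainIndex : Ordinal.{u} :=
  sSup {o | ∃ K : ℝ, 1 ≤ K ∧ o = bourgainIndexAt B K}

end Index

/-! ### Restrictions -/

/-! Lower bound. Unit vectors with indices in a set of `S_n` satisfy a lower ℓ¹ estimate with
constant `θ_n`, whatever the mode. Since a set of `S_{n+1}` may consist of any number `k` of
successive `S_n`-sets, provided that they lie beyond `k`, the tree of unit vectors over `S_{n+1}`
has order greater than `ω ^ n` (`mem_iterDerivedTree_of_schreier`).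

Upper bound. Two facts show that an ℓ¹-`K`-tree has an empty derivative of order `ω ^ ω`.

(1) Unravel the implicit equation of the norm (`hasSystem`). Given `ε`, choose `m` with `η_{m,n} <
ε` for all large `n`, and a threshold `q`. A family of order at most `q` contributes a factor at
most some `t < 1`, so `L` such steps push the weights below `ε`. A family of order above `q` is
regrouped into an `S_m`-family of unions at the cost of a single factor `ε`, and the process stops
there. Thus `‖y‖` is at most a small error plus a sum of `w_i ‖F_i y‖` with disjoint `F_i`, where
`w_i ≤ ε` unless `F_i` is a singleton, and where the minima of the `F_i` have complexity at most
some `R` that does not depend on `y`.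

(2) Below a node of rank `ω ^ (R + 1)` there are convex-type averages `y` of successive blocks, up
to small perturbations, such that a set of complexity `R` hits only blocks of small total weight
(`hasAverages`).

On a block that contains none of the minima, only sets starting before it matter. They are no more
numerous than the coordinates preceding the block, so one modified `S_p`-family contains their
traces and they contribute at most a multiple of `ε`. Blocks that do contain minima have small total
weight. Hence `‖y‖ < 1 / K`, against the ℓ¹ estimate. A copy of ℓ¹ would give an ℓ¹-tree equal to
all of its derivatives, which is excluded by the same bound. -/

theorem restrictTo_apply_of_mem {E : Set ℕ+} {k : ℕ+} (h : k ∈ E) (x : ℕ+ →₀ ℝ) :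
    restrictTo E x k = x k := by
  classical exact Finsupp.filter_apply_pos _ _ h

theorem restrictTo_apply_of_notMem {E : Set ℕ+} {k : ℕ+} (h : k ∉ E) (x : ℕ+ →₀ ℝ) :
    restrictTo E x k = 0 := by
  classical exact Finsupp.filter_apply_neg _ _ h

theorem restrictTo_restrictTo (E F : Set ℕ+) (x : ℕ+ →₀ ℝ) :
    restrictTo E (restrictTo F x) = restrictTo (E ∩ F) x := by
  ext k
  by_cases h1 : k ∈ E
  · by_cases h2 : k ∈ F
    · rw [restrictTo_apply_of_mem h1, restrictTo_apply_of_mem h2,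
        restrictTo_apply_of_mem (mem_inter h1 h2)]
    · rw [restrictTo_apply_of_mem h1, restrictTo_apply_of_notMem h2,
        restrictTo_apply_of_notMem fun h => h2 h.2]
  · rw [restrictTo_apply_of_notMem h1, restrictTo_apply_of_notMem fun h => h1 h.1]

theorem restrictTo_restrictTo_of_subset {E F : Set ℕ+} (h : E ⊆ F) (x : ℕ+ →₀ ℝ) :
    restrictTo E (restrictTo F x) = restrictTo E x := by
  rw [restrictTo_restrictTo, inter_eq_left.mpr h]

theorem restrictTo_univ (x : ℕ+ →₀ ℝ) : restrictTo univ x = x := by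
  ext k
  exact restrictTo_apply_of_mem (mem_univ k) x

theorem restrictTo_eq_zero {E : Set ℕ+} {x : ℕ+ →₀ ℝ} (h : ∀ k ∈ E, x k = 0) :
    restrictTo E x = 0 := by
  ext k
  by_cases hk : k ∈ E
  · rw [restrictTo_apply_of_mem hk, h k hk]; rfl
  · rw [restrictTo_apply_of_notMem hk]; rfl

theorem restrictTo_congr {E F : Set ℕ+} {x : ℕ+ →₀ ℝ}
    (h : ∀ k, x k ≠ 0 → (k ∈ E ↔ k ∈ F)) : restrictTo E x = restrictTo F x := by
  ext k
  by_cases hx : x k = 0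
  · have : ∀ G : Set ℕ+, restrictTo G x k = 0 := fun G => by
      by_cases hk : k ∈ G
      · rw [restrictTo_apply_of_mem hk, hx]
      · rw [restrictTo_apply_of_notMem hk]
    rw [this, this]
  · by_cases hk : k ∈ E
    · rw [restrictTo_apply_of_mem hk, restrictTo_apply_of_mem ((h k hx).mp hk)]
    · rw [restrictTo_apply_of_notMem hk,
        restrictTo_apply_of_notMem fun h' => hk ((h k hx).mpr h')]

theorem czeroNorm_restrictTo_le (E : Set ℕ+) (x : ℕ+ →₀ ℝ) :
    czeroNorm (restrictTo E x) ≤ czeroNorm x := by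
  refine ciSup_le fun k => ?_
  by_cases hk : k ∈ E
  · rw [restrictTo_apply_of_mem hk]; exact abs_le_czeroNorm x k
  · rw [restrictTo_apply_of_notMem hk, abs_zero]; exact czeroNorm_nonneg x

/-! ### Decompositions of Schreier sets -/

/-- `F[G]` with the successive sets indexed by their minima. -/
def minBracket (F G : Set (Finset ℕ+)) : Set (Finset ℕ+) :=
  {A | ∃ B ∈ F, ∃ H : ℕ+ → Finset ℕ+,
      (∀ b ∈ B, H b ∈ G) ∧
      (∀ b ∈ B, IsLeast (H b : Set ℕ+) b) ∧
      (∀ b ∈ B, ∀ c ∈ B, b < c → ∀ x ∈ H b, ∀ y ∈ H c, x < y) ∧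
      A = B.biUnion H}

theorem familyBracket_eq_minBracket (F G : Set (Finset ℕ+)) :
    familyBracket F G = minBracket F G := by
  classical
  ext A
  constructor
  · rintro ⟨k, H, m, hH, hm, hlt, hmem, rfl⟩
    have hinj : Function.Injective m := by
      intro i j hij
      by_contra hne
      rcases lt_or_gt_of_ne hne with h | h
      · exact (hlt i j h _ (hm i).1 _ (hm j).1).ne hij
      · exact (hlt j i h _ (hm j).1 _ (hm i).1).ne hij.symm
    have hext : ∀ i, Function.extend m H (fun _ => ∅) (m i) = H i := fun i =>
      hinj.extend_apply H _ i
    refine ⟨Finset.univ.image m, hmem, Function.extend m H (fun _ => ∅), ?_, ?_, ?_, ?_⟩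
    · simp only [Finset.mem_image, Finset.mem_univ, true_and, forall_exists_index,
        forall_apply_eq_imp_iff, hext]
      exact hH
    · simp only [Finset.mem_image, Finset.mem_univ, true_and, forall_exists_index,
        forall_apply_eq_imp_iff, hext]
      exact hm
    · simp only [Finset.mem_image, Finset.mem_univ, true_and, forall_exists_index,
        forall_apply_eq_imp_iff, hext]
      intro i j hij
      refine hlt i j ?_
      by_contra hn
      rcases (not_lt.mp hn).lt_or_eq with h | h
      · exact lt_asymm hij (hlt j i h _ (hm j).1 _ (hm i).1)
      · exact hij.ne (by rw [h])
    · ext a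
      simp [hext]
  · rintro ⟨B, hB, H, hG, hm, hlt, rfl⟩
    have hmem : ∀ i, B.orderEmbOfFin rfl i ∈ B := fun i => B.orderEmbOfFin_mem rfl i
    have himg : Finset.univ.image (fun i => B.orderEmbOfFin rfl i) = B := by
      ext a
      simp
    refine ⟨B.card, fun i => H (B.orderEmbOfFin rfl i), fun i => B.orderEmbOfFin rfl i,
      fun i => hG _ (hmem i), fun i => hm _ (hmem i), ?_, by rwa [himg], ?_⟩
    · intro i j hij
      exact hlt _ (hmem i) _ (hmem j) ((B.orderEmbOfFin rfl).lt_iff_lt.mpr hij)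
    · conv_lhs => rw [← himg]
      rw [Finset.image_biUnion]

theorem minBracket_mono {F G G' : Set (Finset ℕ+)} (h : G ⊆ G') :
    minBracket F G ⊆ minBracket F G' := by
  rintro A ⟨B, hB, H, hG, hr⟩
  exact ⟨B, hB, H, fun b hb => h (hG b hb), hr⟩

/-- Every inner set is determined by its minimum `d`, and the outer block containing `d` by
disjointness. The minima inside the block of `b` form a `G`-set with least element `b`, so all the
minima together form an `F[G]`-set. -/
theorem minBracket_assoc_subset (F G K : Set (Finset ℕ+)) :
    minBracket F (minBracket G K) ⊆ minBracket (minBracket F G) K := by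
  classical
  rintro A ⟨B, hB, H, hG, hm, hlt, rfl⟩
  choose! C hC J hK hJm hJlt hHJ using hG
  have hCH : ∀ b ∈ B, ∀ d ∈ C b, ∀ x ∈ J b d, x ∈ H b := by
    intro b hb d hd x hx
    rw [hHJ b hb]
    exact Finset.mem_biUnion.mpr ⟨d, hd, hx⟩
  have hCH' : ∀ b ∈ B, ∀ d ∈ C b, d ∈ H b := fun b hb d hd =>
    hCH b hb d hd d (hJm b hb d hd).1
  have hCleast : ∀ b ∈ B, IsLeast (C b : Set ℕ+) b := by
    intro b hb
    refine ⟨?_, fun d hd => (hm b hb).2 (hCH' b hb d hd)⟩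
    have h1 : b ∈ H b := (hm b hb).1
    rw [hHJ b hb] at h1
    obtain ⟨d, hd, hbd⟩ := Finset.mem_biUnion.mp h1
    have h2 : d ≤ b := (hJm b hb d hd).2 hbd
    have h3 : b ≤ d := (hm b hb).2 (hCH' b hb d hd)
    rw [le_antisymm h2 h3] at hd
    exact hd
  have huniq : ∀ b ∈ B, ∀ c ∈ B, ∀ d, d ∈ C b → d ∈ C c → b = c := by
    intro b hb c hc d hdb hdc
    by_contra hne
    rcases lt_or_gt_of_ne hne with h | h
    · exact lt_irrefl d (hlt b hb c hc h d (hCH' b hb d hdb) d (hCH' c hc d hdc))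
    · exact lt_irrefl d (hlt c hc b hb h d (hCH' c hc d hdc) d (hCH' b hb d hdb))
  have hex : ∀ d, d ∈ B.biUnion C → ∃ b ∈ B, d ∈ C b := fun d hd => Finset.mem_biUnion.mp hd
  choose! β hβB hβC using hex
  have hβ : ∀ b ∈ B, ∀ d ∈ C b, β d = b := by
    intro b hb d hd
    have hd' := Finset.mem_biUnion.mpr ⟨b, hb, hd⟩
    exact huniq _ (hβB d hd') b hb d (hβC d hd') hd
  refine ⟨B.biUnion C, ⟨B, hB, C, hC, hCleast, ?_, rfl⟩, fun d => J (β d) d, ?_, ?_, ?_, ?_⟩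
  · intro b hb c hc hbc x hx y hy
    exact hlt b hb c hc hbc x (hCH' b hb x hx) y (hCH' c hc y hy)
  · intro d hd
    exact hK _ (hβB d hd) d (hβC d hd)
  · intro d hd
    exact hJm _ (hβB d hd) d (hβC d hd)
  · intro d hd e he hde x hx y hy
    have hdB := hβB d hd
    have heB := hβB e he
    rcases lt_trichotomy (β d) (β e) with h | h | h
    · exact hlt _ hdB _ heB h x (hCH _ hdB d (hβC d hd) x hx) y (hCH _ heB e (hβC e he) y hy)
    · have hy' : y ∈ J (β e) e := hy
      rw [← h] at hy'
      have heC := hβC e he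
      rw [← h] at heC
      exact hJlt _ hdB d (hβC d hd) e heC hde x hx y hy'
    · exact absurd (hlt _ heB _ hdB h e (hCH' _ heB e (hβC e he)) d
        (hCH' _ hdB d (hβC d hd))) hde.asymm
  · ext a
    simp only [Finset.mem_biUnion]
    constructor
    · rintro ⟨b, hb, hab⟩
      rw [hHJ b hb] at hab
      obtain ⟨d, hd, had⟩ := Finset.mem_biUnion.mp hab
      refine ⟨d, ⟨b, hb, hd⟩, ?_⟩
      rwa [hβ b hb d hd]
    · rintro ⟨d, ⟨b, hb, hd⟩, had⟩
      rw [hβ b hb d hd] at had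
      exact ⟨b, hb, hCH b hb d hd a had⟩

theorem subset_minBracket {F G : Set (Finset ℕ+)} (h0 : ∅ ∈ F) (h1 : ∀ a : ℕ+, {a} ∈ F) :
    G ⊆ minBracket F G := by
  intro A hA
  rcases A.eq_empty_or_nonempty with rfl | hne
  · exact ⟨∅, h0, fun _ => ∅, by simp, by simp, by simp, by simp⟩
  · refine ⟨{A.min' hne}, h1 _, fun _ => A, by simpa using hA, ?_, ?_, by simp⟩
    · intro b hb
      rw [Finset.mem_singleton.mp hb]
      exact A.isLeast_min' hne
    · intro b hb c hc hbc
      rw [Finset.mem_singleton.mp hb, Finset.mem_singleton.mp hc] at hbc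
      exact absurd hbc (lt_irrefl _)

theorem singleton_mem_schreierOne (a : ℕ+) : {a} ∈ schreierOne := by
  intro b _
  rw [Finset.card_singleton]
  exact b.pos

theorem schreier_succ (n : ℕ) : schreier (n + 1) = minBracket schreierOne (schreier n) :=
  familyBracket_eq_minBracket _ _

theorem schreier_subset_succ (n : ℕ) : schreier n ⊆ schreier (n + 1) := by
  rw [schreier_succ]
  exact subset_minBracket (by simp [schreierOne]) singleton_mem_schreierOne

theorem schreier_mono : Monotone schreier := monotone_nat_of_le_succ schreier_subset_succ

theorem schreier_add_subset (a b : ℕ) :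
    schreier (a + b) ⊆ minBracket (schreier a) (schreier b) := by
  induction a with
  | zero =>
    rw [zero_add]
    exact subset_minBracket (by simp [schreier]) (by simp [schreier])
  | succ a ih =>
    rw [show a + 1 + b = a + b + 1 by omega, schreier_succ (a + b), schreier_succ a]
    exact (minBracket_mono ih).trans (minBracket_assoc_subset _ _ _)

/-! ### Families of sets indexed by finsets -/

/-- Pairwise disjointness of the sets `E i`, `i ∈ J`, and, in the mode `U`, successivity in the
order of the points `m i`. -/
def SeparatedOn (s : TsirelsonMode) {ι : Type*} (J : Finset ι) (E : ι → Set ℕ+)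
    (m : ι → ℕ+) : Prop :=
  (∀ i ∈ J, ∀ j ∈ J, i ≠ j → Disjoint (E i) (E j)) ∧
    (s = TsirelsonMode.U → ∀ i ∈ J, ∀ j ∈ J, m i < m j → ∀ a ∈ E i, ∀ b ∈ E j, a < b)

theorem SeparatedOn.subset {s : TsirelsonMode} {ι : Type*} {J J' : Finset ι} {E : ι → Set ℕ+}
    {m : ι → ℕ+} (h : SeparatedOn s J E m) (hJ : J' ⊆ J) : SeparatedOn s J' E m :=
  ⟨fun i hi j hj => h.1 i (hJ hi) j (hJ hj), fun hs i hi j hj => h.2 hs i (hJ hi) j (hJ hj)⟩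

/-- Successive sets are disjoint, so only the passage from `M` to `U` has to be excluded. -/
theorem SeparatedOn.mode {s t : TsirelsonMode} {ι : Type*} {J : Finset ι} {E : ι → Set ℕ+}
    {m : ι → ℕ+} (h : SeparatedOn s J E m) (hst : s = TsirelsonMode.M → t = TsirelsonMode.M) :
    SeparatedOn t J E m := by
  refine ⟨h.1, fun ht => h.2 ?_⟩
  cases s with
  | M => rw [hst rfl] at ht; cases ht
  | U => rfl

theorem SeparatedOn.injOn {s : TsirelsonMode} {ι : Type*} {J : Finset ι} {E : ι → Set ℕ+}
    {m : ι → ℕ+} (h : SeparatedOn s J E m) (hm : ∀ i ∈ J, IsLeast (E i) (m i)) :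
    Set.InjOn m (J : Set ι) := by
  intro i hi j hj hij
  by_contra hne
  refine Set.disjoint_left.mp (h.1 i hi j hj hne) (hm i hi).1 ?_
  rw [hij]
  exact (hm j hj).1

theorem AdaptedFamily.separatedOn {n : ℕ+} {s : TsirelsonMode} {k : ℕ} {E : Fin k → Set ℕ+}
    (h : AdaptedFamily n s E) {m : Fin k → ℕ+} (hm : ∀ i, IsLeast (E i) (m i)) :
    SeparatedOn s Finset.univ E m := by
  refine ⟨fun i _ j _ => h.disjoint i j, ?_⟩
  rintro rfl i - j - hij
  have h2 : ∀ i j, i < j → ∀ a ∈ E i, ∀ b ∈ E j, a < b := h.2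
  refine h2 i j ?_
  by_contra hn
  rcases (not_lt.mp hn).lt_or_eq with h | h
  · exact lt_asymm hij (h2 j i h _ (hm j).1 _ (hm i).1)
  · exact hij.ne (by rw [h])

/-- A family with minima in `S_{n+c}` is grouped into subfamilies with minima in `S_c`, whose
unions have minima in `S_n`. -/
theorem SeparatedOn.exists_regroup {s : TsirelsonMode} {ι : Type*} {J : Finset ι}
    {E : ι → Set ℕ+} {m : ι → ℕ+} (h : SeparatedOn s J E m)
    (hm : ∀ i ∈ J, IsLeast (E i) (m i)) {n c : ℕ} (hS : J.image m ∈ schreier (n + c)) :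
    ∃ B ∈ schreier n, ∃ J' : ℕ+ → Finset ι,
      (∀ b ∈ B, J' b ⊆ J ∧ (J' b).image m ∈ schreier c ∧ IsLeast (⋃ i ∈ J' b, E i) b) ∧
      SeparatedOn s B (fun b => ⋃ i ∈ J' b, E i) id ∧
      ∀ φ : ι → ℝ, ∑ i ∈ J, φ i = ∑ b ∈ B, ∑ i ∈ J' b, φ i := by
  classical
  obtain ⟨B, hB, H, hH, hl, hlt, heq⟩ := schreier_add_subset n c hS
  have hmem : ∀ b i, i ∈ J.filter (fun i => m i ∈ H b) ↔ i ∈ J ∧ m i ∈ H b := fun b i =>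
    Finset.mem_filter
  have hsurj : ∀ b ∈ B, ∀ a ∈ H b, ∃ i ∈ J, m i = a := by
    intro b hb a ha
    have : a ∈ J.image m := by
      rw [heq]
      exact Finset.mem_biUnion.mpr ⟨b, hb, ha⟩
    exact Finset.mem_image.mp this
  have hdisj : ∀ b ∈ B, ∀ c ∈ B, b ≠ c → ∀ a, a ∈ H b → a ∉ H c := by
    intro b hb c hc hne a hab hac
    rcases lt_or_gt_of_ne hne with h | h
    · exact lt_irrefl a (hlt b hb c hc h a hab a hac)
    · exact lt_irrefl a (hlt c hc b hb h a hac a hab)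
  refine ⟨B, hB, fun b => J.filter (fun i => m i ∈ H b), ?_, ⟨?_, ?_⟩, ?_⟩
  · intro b hb
    refine ⟨Finset.filter_subset _ _, ?_, ?_, ?_⟩
    · have : (J.filter (fun i => m i ∈ H b)).image m = H b := by
        ext a
        simp only [Finset.mem_image, hmem]
        constructor
        · rintro ⟨i, ⟨-, hi⟩, rfl⟩
          exact hi
        · intro ha
          obtain ⟨i, hi, rfl⟩ := hsurj b hb a ha
          exact ⟨i, ⟨hi, ha⟩, rfl⟩
      rw [this]
      exact hH b hb
    · obtain ⟨i, hi, hib⟩ := hsurj b hb b (hl b hb).1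
      refine Set.mem_biUnion (x := i) ((hmem b i).mpr ⟨hi, ?_⟩) ?_
      · rw [hib]; exact (hl b hb).1
      · rw [← hib]; exact (hm i hi).1
    · intro a ha
      obtain ⟨i, hi, hai⟩ := Set.mem_iUnion₂.mp ha
      obtain ⟨hiJ, hiH⟩ := (hmem b i).mp hi
      exact ((hl b hb).2 hiH).trans ((hm i hiJ).2 hai)
  · intro b hb c hc hne
    rw [Set.disjoint_left]
    intro a ha ha'
    obtain ⟨i, hi, hai⟩ := Set.mem_iUnion₂.mp ha
    obtain ⟨j, hj, haj⟩ := Set.mem_iUnion₂.mp ha'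
    obtain ⟨hiJ, hiH⟩ := (hmem b i).mp hi
    obtain ⟨hjJ, hjH⟩ := (hmem c j).mp hj
    refine Set.disjoint_left.mp (h.1 i hiJ j hjJ ?_) hai haj
    rintro rfl
    exact hdisj b hb c hc hne _ hiH hjH
  · intro hs b hb c hc hbc a ha a' ha'
    obtain ⟨i, hi, hai⟩ := Set.mem_iUnion₂.mp ha
    obtain ⟨j, hj, haj⟩ := Set.mem_iUnion₂.mp ha'
    obtain ⟨hiJ, hiH⟩ := (hmem b i).mp hi
    obtain ⟨hjJ, hjH⟩ := (hmem c j).mp hj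
    exact h.2 hs i hiJ j hjJ (hlt b hb c hc hbc _ hiH _ hjH) a hai a' haj
  · intro φ
    rw [← Finset.sum_biUnion]
    · refine Finset.sum_congr ?_ fun _ _ => rfl
      ext i
      simp only [Finset.mem_biUnion, hmem]
      constructor
      · intro hi
        have : m i ∈ B.biUnion H := heq ▸ Finset.mem_image_of_mem m hi
        obtain ⟨b, hb, hib⟩ := Finset.mem_biUnion.mp this
        exact ⟨b, hb, hi, hib⟩
      · rintro ⟨b, -, hi, -⟩
        exact hi
    · intro b hb c hc hne
      rw [Function.onFun, Finset.disjoint_left]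
      intro i hi hi'
      exact hdisj b hb c hc hne _ ((hmem b i).mp hi).2 ((hmem c i).mp hi').2

/-! ### Lower estimates of the norm by sums over separated families. -/

namespace TsirelsonData

variable (D : TsirelsonData)

theorem tnorm_nonneg (x : ℕ+ →₀ ℝ) : 0 ≤ D.tnorm x := D.isIntermediateNorm_tnorm.nonneg x

theorem tnorm_zero : D.tnorm 0 = 0 := by
  refine le_antisymm ?_ (D.tnorm_nonneg 0)
  have h := D.isIntermediateNorm_tnorm.le_lone 0
  rwa [show loneNorm (0 : ℕ+ →₀ ℝ) = 0 by simp [loneNorm]] at h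

theorem iterNorm_restrictTo_le (i : ℕ) (E : Set ℕ+) (x : ℕ+ →₀ ℝ) :
    D.iterNorm i (restrictTo E x) ≤ D.iterNorm i x := by
  induction i generalizing x with
  | zero => exact czeroNorm_restrictTo_le E x
  | succ i ih =>
    refine D.normStep_le ((czeroNorm_restrictTo_le E x).trans (le_max_left _ _)) ?_
    intro n k F hF
    refine le_trans ?_ (D.sum_le_normStep (D.isIntermediateNorm_iterNorm i) x hF)
    refine mul_le_mul_of_nonneg_left (Finset.sum_le_sum fun j _ => ?_) (D.θ_mem n).1.le
    rw [restrictTo_restrictTo, inter_comm, ← restrictTo_restrictTo]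
    exact ih _

theorem tnorm_restrictTo_le (E : Set ℕ+) (x : ℕ+ →₀ ℝ) :
    D.tnorm (restrictTo E x) ≤ D.tnorm x :=
  ciSup_le fun i => (D.iterNorm_restrictTo_le i E x).trans (D.iterNorm_le_tnorm i x)

/-- Enumerating the sets by increasing minima turns the finset-indexed family into an adapted one;
in the mode `U` this is the order in which they are successive. -/
theorem mul_sum_tnorm_le {ι : Type*} {J : Finset ι} {E : ι → Set ℕ+} {m : ι → ℕ+} {n : ℕ+}
    (hm : ∀ i ∈ J, IsLeast (E i) (m i)) (hS : J.image m ∈ schreier n)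
    (hsep : SeparatedOn (D.σ n) J E m) (x : ℕ+ →₀ ℝ) :
    D.θ n * ∑ i ∈ J, D.tnorm (restrictTo (E i) x) ≤ D.tnorm x := by
  classical
  have hinj := hsep.injOn hm
  set A := J.image m with hA
  have hA' : ∀ j, ∃ i ∈ J, m i = A.orderEmbOfFin rfl j := fun j =>
    Finset.mem_image.mp (A.orderEmbOfFin_mem rfl j)
  choose g hgJ hg using hA'
  have hginj : Function.Injective g := by
    intro i j hij
    have := hg i
    rw [hij, hg j] at this
    exact ((A.orderEmbOfFin rfl).injective this).symm
  have hgsurj : ∀ i ∈ J, ∃ j, g j = i := by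
    intro i hi
    have h1 : m i ∈ Set.range (A.orderEmbOfFin rfl) := by
      rw [Finset.range_orderEmbOfFin]
      exact Finset.mem_image_of_mem m hi
    obtain ⟨j, hj⟩ := h1
    exact ⟨j, hinj (hgJ j) hi ((hg j).trans hj)⟩
  have hsum : ∑ i ∈ J, D.tnorm (restrictTo (E i) x) =
      ∑ j, D.tnorm (restrictTo (E (g j)) x) := by
    symm
    refine Finset.sum_bij (fun j _ => g j) (fun j _ => hgJ j) (fun i _ j _ h => hginj h) ?_
      fun _ _ => rfl
    intro i hi
    obtain ⟨j, hj⟩ := hgsurj i hi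
    exact ⟨j, Finset.mem_univ j, hj⟩
  have hadapt : AdaptedFamily n (D.σ n) (fun j => E (g j)) := by
    refine ⟨⟨fun j => A.orderEmbOfFin rfl j, fun j => ?_, ?_⟩, ?_⟩
    · have := hm _ (hgJ j)
      rwa [hg j] at this
    · have : Finset.univ.image (fun j => A.orderEmbOfFin rfl j) = A := by
        ext a
        simp
      rw [this]
      exact hS
    · unfold SeparatedFamily
      cases hs : D.σ n with
      | M => exact fun i j hij => hsep.1 _ (hgJ i) _ (hgJ j) (hginj.ne hij)
      | U =>
        intro i j hij
        refine hsep.2 hs _ (hgJ i) _ (hgJ j) ?_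
        rw [hg, hg]
        exact (A.orderEmbOfFin rfl).lt_iff_lt.mpr hij
  rw [hsum]
  refine (D.sum_le_normStep D.isIntermediateNorm_tnorm x hadapt).trans ?_
  exact (D.tnorm_eq x).ge

theorem tnorm_restrictTo_biUnion_sum {ι : Type*} (J : Finset ι) (E : ι → Set ℕ+)
    (x : ℕ+ →₀ ℝ) : ∑ i ∈ J, D.tnorm (restrictTo (E i) (restrictTo (⋃ i ∈ J, E i) x)) =
      ∑ i ∈ J, D.tnorm (restrictTo (E i) x) :=
  Finset.sum_congr rfl fun i hi => by
    have h : E i ⊆ ⋃ i ∈ J, E i := fun a ha => Set.mem_iUnion₂.mpr ⟨i, hi, ha⟩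
    rw [restrictTo_restrictTo_of_subset h]

theorem list_prod_pos (l : List ℕ+) : 0 < (l.map D.θ).prod := by
  refine List.prod_pos fun a ha => ?_
  obtain ⟨j, -, rfl⟩ := List.mem_map.mp ha
  exact (D.θ_mem j).1

/-- Iteration of the inequality that the norm satisfies. -/
theorem list_prod_mul_sum_tnorm_le {s : TsirelsonMode} (l : List ℕ+)
    (hl : s = TsirelsonMode.M → ∀ j ∈ l, D.σ j = TsirelsonMode.M) {ι : Type*} {J : Finset ι}
    {E : ι → Set ℕ+} {m : ι → ℕ+} (hm : ∀ i ∈ J, IsLeast (E i) (m i))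
    (hS : J.image m ∈ schreier (l.map fun j : ℕ+ => (j : ℕ)).sum) (hsep : SeparatedOn s J E m)
    (x : ℕ+ →₀ ℝ) :
    (l.map D.θ).prod * ∑ i ∈ J, D.tnorm (restrictTo (E i) x) ≤ D.tnorm x := by
  induction l generalizing J x with
  | nil =>
    rw [List.map_nil, List.prod_nil, one_mul]
    have h1 : J.card ≤ 1 := by
      rw [← Finset.card_image_of_injOn (hsep.injOn hm)]
      exact hS
    rcases J.eq_empty_or_nonempty with rfl | ⟨i, hi⟩
    · rw [Finset.sum_empty]; exact D.tnorm_nonneg x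
    · have : J = {i} := by
        ext j
        rw [Finset.mem_singleton]
        exact ⟨fun hj => Finset.card_le_one.mp h1 j hj i hi, fun h => h ▸ hi⟩
      rw [this, Finset.sum_singleton]
      exact D.tnorm_restrictTo_le _ _
  | cons n l ih =>
    rw [List.map_cons, List.sum_cons] at hS
    -- The outer `S_n`-family of unions uses up the factor `θ_n`; within each union the remaining
    -- factors are handled by induction.
    obtain ⟨B, hB, J', hJ', hsepB, hsum⟩ := hsep.exists_regroup hm hS
    rw [List.map_cons, List.prod_cons, mul_assoc, hsum, Finset.mul_sum]
    refine le_trans (mul_le_mul_of_nonneg_left (Finset.sum_le_sum fun b hb => ?_)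
      (D.θ_mem n).1.le) (D.mul_sum_tnorm_le (m := id) (fun b hb => (hJ' b hb).2.2)
        (by rwa [Finset.image_id]) (hsepB.mode fun hs => hl hs n List.mem_cons_self) x)
    rw [← D.tnorm_restrictTo_biUnion_sum (J' b)]
    exact ih (fun hs j hj => hl hs j (List.mem_cons_of_mem n hj))
      (fun i hi => hm i ((hJ' b hb).1 hi)) (hJ' b hb).2.1 (hsep.subset (hJ' b hb).1) _

end TsirelsonData

/-! ### Sets of bounded complexity -/

/-- Sets of complexity at most `n`: what lies beyond a point `g` of such a set is covered by at
most `g` sets of complexity at most `n - 1`. -/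
def coverFamily : ℕ → Set (Finset ℕ+)
  | 0 => {∅}
  | n + 1 => {G | ∀ g ∈ G, ∃ l : List (Finset ℕ+), l.length ≤ (g : ℕ) ∧
      (∀ A ∈ l, A ∈ coverFamily n) ∧ ∀ x ∈ G, g < x → ∃ A ∈ l, x ∈ A}

theorem coverFamily_of_subset {n : ℕ} {A B : Finset ℕ+} (hA : A ∈ coverFamily n)
    (h : B ⊆ A) : B ∈ coverFamily n := by
  cases n with
  | zero => exact Finset.subset_empty.mp (h.trans_eq hA)
  | succ n =>
    intro g hg
    obtain ⟨l, h1, h2, h3⟩ := hA g (h hg)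
    exact ⟨l, h1, h2, fun x hx => h3 x (h hx)⟩

theorem coverFamily_subset_succ (n : ℕ) : coverFamily n ⊆ coverFamily (n + 1) := by
  induction n with
  | zero =>
    rintro A rfl g hg
    exact absurd hg (Finset.notMem_empty g)
  | succ n ih =>
    intro A hA g hg
    obtain ⟨l, h1, h2, h3⟩ := hA g hg
    exact ⟨l, h1, fun B hB => ih (h2 B hB), h3⟩

theorem coverFamily_mono : Monotone coverFamily := monotone_nat_of_le_succ coverFamily_subset_succ

theorem empty_mem_coverFamily (n : ℕ) : ∅ ∈ coverFamily n :=
  coverFamily_mono (Nat.zero_le n) rfl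

theorem singleton_mem_coverFamily (a : ℕ+) : {a} ∈ coverFamily 1 := by
  intro g hg
  refine ⟨[], Nat.zero_le _, by simp, fun x hx hgx => ?_⟩
  rw [Finset.mem_singleton.mp hg, Finset.mem_singleton.mp hx] at hgx
  exact absurd hgx (lt_irrefl a)

/-- In the modified case the sets `G i` may interleave, so their union need not be a Schreier set,
but it can be covered. A point `g` of `G i`, with `m i` in the block of `b`, satisfies `|B| ≤ b ≤ m
i ≤ g`, and the whole union splits into `|B|` parts of smaller complexity. -/
theorem biUnion_mem_coverFamily {ι : Type*} (p r : ℕ) {J : Finset ι} {m : ι → ℕ+}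
    (hinj : Set.InjOn m (J : Set ι)) (hS : J.image m ∈ schreier p) {G : ι → Finset ℕ+}
    (hG : ∀ i ∈ J, G i ∈ coverFamily r) (hm : ∀ i ∈ J, ∀ g ∈ G i, m i ≤ g) :
    J.biUnion G ∈ coverFamily (p + r) := by
  classical
  induction p generalizing J with
  | zero =>
    rw [zero_add]
    have h1 : J.card ≤ 1 := by
      rw [← Finset.card_image_of_injOn hinj]
      exact hS
    rcases J.eq_empty_or_nonempty with rfl | ⟨i, hi⟩
    · rw [Finset.biUnion_empty]; exact empty_mem_coverFamily r
    · have : J = {i} := by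
        ext j
        rw [Finset.mem_singleton]
        exact ⟨fun hj => Finset.card_le_one.mp h1 j hj i hi, fun h => h ▸ hi⟩
      rw [this, Finset.singleton_biUnion]
      exact hG i hi
  | succ p ih =>
    rw [schreier_succ] at hS
    obtain ⟨B, hB, H, hH, hl, -, heq⟩ := hS
    rw [Nat.add_right_comm]
    have hex : ∀ i ∈ J, ∃ b ∈ B, m i ∈ H b := fun i hi =>
      Finset.mem_biUnion.mp (heq ▸ Finset.mem_image_of_mem m hi)
    intro g hg
    obtain ⟨i, hi, hgi⟩ := Finset.mem_biUnion.mp hg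
    obtain ⟨b, hb, hib⟩ := hex i hi
    refine ⟨B.toList.map fun b => (J.filter fun i => m i ∈ H b).biUnion G, ?_, ?_, ?_⟩
    · rw [List.length_map, Finset.length_toList]
      exact (hB b hb).trans (((hl b hb).2 hib).trans (hm i hi g hgi))
    · intro A hA
      obtain ⟨c, hc, rfl⟩ := List.mem_map.mp hA
      rw [Finset.mem_toList] at hc
      refine ih (hinj.mono fun i hi => (Finset.mem_filter.mp hi).1) ?_
        (fun i hi => hG i (Finset.mem_filter.mp hi).1)
        (fun i hi => hm i (Finset.mem_filter.mp hi).1)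
      have : (J.filter (fun i => m i ∈ H c)).image m = H c := by
        ext a
        simp only [Finset.mem_image, Finset.mem_filter]
        constructor
        · rintro ⟨i, ⟨-, hi⟩, rfl⟩
          exact hi
        · intro ha
          have : a ∈ J.image m := heq ▸ Finset.mem_biUnion.mpr ⟨c, hc, ha⟩
          obtain ⟨i, hi, rfl⟩ := Finset.mem_image.mp this
          exact ⟨i, ⟨hi, ha⟩, rfl⟩
      rw [this]
      exact hH c hc
    · intro x hx _
      obtain ⟨j, hj, hxj⟩ := Finset.mem_biUnion.mp hx
      obtain ⟨c, hc, hjc⟩ := hex j hj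
      exact ⟨_, List.mem_map.mpr ⟨c, Finset.mem_toList.mpr hc, rfl⟩,
        Finset.mem_biUnion.mpr ⟨j, Finset.mem_filter.mpr ⟨hj, hjc⟩, hxj⟩⟩

theorem exists_isLeast_pnat {E : Set ℕ+} (h : E.Nonempty) : ∃ a, IsLeast E a :=
  ⟨wellFounded_lt.min E h, WellFounded.min_mem _ E h,
    fun _ hb => not_lt.mp (WellFounded.not_lt_min _ E hb)⟩

/-! ### Decomposition of the norm into weighted systems. -/

namespace TsirelsonData

variable (D : TsirelsonData)

/-- The suprema in the implicit equation are replaced by almost extremal terms, at the cost of `τ`.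
-/
theorem exists_abs_or_adapted (x : ℕ+ →₀ ℝ) {τ : ℝ} (hτ : 0 < τ) :
    (∃ k, D.tnorm x ≤ |x k| + τ) ∨ ∃ (n : ℕ+) (k : ℕ) (E : Fin k → Set ℕ+),
      AdaptedFamily n (D.σ n) E ∧ D.tnorm x ≤ D.θ n * ∑ i, D.tnorm (restrictTo (E i) x) + τ := by
  rw [D.tnorm_eq x]
  rcases le_total (czeroNorm x) (sSup (D.adaptedSums D.tnorm x)) with h | h
  · rw [max_eq_right h]
    rcases (D.adaptedSums D.tnorm x).eq_empty_or_nonempty with he | hne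
    · left
      rw [he, Real.sSup_empty]
      exact ⟨1, by positivity⟩
    · right
      obtain ⟨r, ⟨n, k, E, hE, rfl⟩, hr⟩ := exists_lt_of_lt_csSup hne (sub_lt_self _ hτ)
      exact ⟨n, k, E, hE, by linarith⟩
  · left
    rw [max_eq_left h]
    obtain ⟨k, hk⟩ := exists_lt_of_lt_ciSup (sub_lt_self (⨆ k, |x k|) hτ)
    exact ⟨k, by unfold czeroNorm; linarith⟩

/-- Disjoint families with minima in a Schreier family of fixed order have sums dominated by the
norm. -/
theorem sum_tnorm_le_of_schreier {p : ℕ+} (hp : D.σ p = TsirelsonMode.M) (M : ℕ) {ι : Type*}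
    {J : Finset ι} {E : ι → Set ℕ+} {m : ι → ℕ+} (hm : ∀ i ∈ J, IsLeast (E i) (m i))
    (hS : J.image m ∈ schreier M) (hsep : SeparatedOn TsirelsonMode.M J E m) (x : ℕ+ →₀ ℝ) :
    ∑ i ∈ J, D.tnorm (restrictTo (E i) x) ≤ (D.θ p)⁻¹ ^ M * D.tnorm x := by
  -- `M` modified steps of order `p` suffice, since `M ≤ M * p`.
  have h := D.list_prod_mul_sum_tnorm_le (s := TsirelsonMode.M) (List.replicate M p)
    (fun _ j hj => (List.eq_of_mem_replicate hj) ▸ hp) hm (schreier_mono ?_ hS) hsep x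
  · rw [List.map_replicate, List.prod_replicate] at h
    rw [inv_pow, inv_mul_eq_div, le_div_iff₀' (pow_pos (D.θ_mem p).1 M)]
    exact h
  · rw [List.map_replicate, List.sum_replicate, smul_eq_mul]
    exact Nat.le_mul_of_pos_right M p.pos

/-- A list almost realizing `η_{m,n}` gives `θ_{m+n} ≤ ε θ_{n₁} ⋯ θ_{n_s}`. After grouping into an
`S_m`-family of `S_n`-families, the product of the `θ_{n_i}` is absorbed by the norm of each union.
The mode condition in `η` is what allows this iteration when the sets are merely disjoint. -/
theorem exists_regroup_of_eta_lt {m n : ℕ+} {ε : ℝ} (hη : D.eta m n < ε) {ι : Type*}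
    {J : Finset ι} {E : ι → Set ℕ+} {μ : ι → ℕ+} (hμ : ∀ i ∈ J, IsLeast (E i) (μ i))
    (hS : J.image μ ∈ schreier (m + n : ℕ+)) (hsep : SeparatedOn (D.σ (m + n)) J E μ)
    (x : ℕ+ →₀ ℝ) :
    ∃ B ∈ schreier m, ∃ U : ℕ+ → Set ℕ+, (∀ b ∈ B, IsLeast (U b) b) ∧
      SeparatedOn TsirelsonMode.M B U id ∧
      D.θ (m + n) * ∑ i ∈ J, D.tnorm (restrictTo (E i) x) ≤
        ε * ∑ b ∈ B, D.tnorm (restrictTo (U b) x) := by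
  have hne : {r | ∃ l : List ℕ+, (n : ℕ) ≤ (l.map fun j : ℕ+ => (j : ℕ)).sum ∧
      (D.σ (m + n) = TsirelsonMode.M → ∀ j ∈ l, D.σ j = TsirelsonMode.M) ∧
      r = D.θ (m + n) / (l.map D.θ).prod}.Nonempty := ⟨_, [m + n], by simp, by simp, rfl⟩
  obtain ⟨r, ⟨l, hl, hmode, rfl⟩, hr⟩ := exists_lt_of_csInf_lt hne hη
  rw [PNat.add_coe] at hS
  obtain ⟨B, hB, J', hJ', hsepB, hsum⟩ := hsep.exists_regroup hμ hS
  refine ⟨B, hB, _, fun b hb => (hJ' b hb).2.2, hsepB.mode fun _ => rfl, ?_⟩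
  rw [hsum, Finset.mul_sum, Finset.mul_sum]
  refine Finset.sum_le_sum fun b hb => ?_
  have h := D.list_prod_mul_sum_tnorm_le l hmode (fun i hi => hμ i ((hJ' b hb).1 hi))
    (schreier_mono hl (hJ' b hb).2.1) (hsep.subset (hJ' b hb).1)
    (restrictTo (⋃ i ∈ J' b, E i) x)
  rw [D.tnorm_restrictTo_biUnion_sum] at h
  have hpos := D.list_prod_pos l
  have hθ : D.θ (m + n) ≤ ε * (l.map D.θ).prod := ((div_lt_iff₀ hpos).mp hr).le
  have hε : 0 ≤ ε := ((D.eta_mem_Icc m n).1.trans_lt hη).le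
  calc _ ≤ ε * (l.map D.θ).prod * ∑ i ∈ J' b, D.tnorm (restrictTo (E i) x) :=
        mul_le_mul_of_nonneg_right hθ (Finset.sum_nonneg fun i _ => D.tnorm_nonneg _)
    _ ≤ _ := by
        rw [mul_assoc]
        exact mul_le_mul_of_nonneg_left h hε

/-- Weighted families of disjoint sets, such as those that arise from an iteration of the implicit
equation of the norm: weights are at most `ε`, except at singletons, and the weighted sums are
dominated by the norm. -/
structure IsSystem (ε C : ℝ) {ι : Type} [Fintype ι] (F : ι → Set ℕ+) (f : ι → ℕ+)
    (w : ι → ℝ) : Prop where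
  least : ∀ i, IsLeast (F i) (f i)
  disj : ∀ i j, i ≠ j → Disjoint (F i) (F j)
  nonneg : ∀ i, 0 ≤ w i
  le_or_eq : ∀ i, w i ≤ ε ∨ F i = {f i}
  sum_le : ∀ z, ∑ i, w i * D.tnorm (restrictTo (F i) z) ≤ C * D.tnorm z

variable {D}

theorem isSystem_empty {ε C : ℝ} (hC : 0 ≤ C) :
    D.IsSystem ε C (ι := Empty) (fun _ => ∅) (fun _ => 1) (fun _ => 0) where
  least i := i.elim
  disj i := i.elim
  nonneg i := i.elim
  le_or_eq i := i.elim
  sum_le z := by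
    rw [Finset.univ_eq_empty, Finset.sum_empty]
    exact mul_nonneg hC (D.tnorm_nonneg z)

theorem isSystem_unit {ε C : ℝ} (hC : 1 ≤ C) {E : Set ℕ+} {a : ℕ+} (ha : IsLeast E a)
    (h : 1 ≤ ε ∨ E = {a}) :
    D.IsSystem ε C (ι := Unit) (fun _ => E) (fun _ => a) (fun _ => 1) where
  least _ := ha
  disj i j hij := absurd rfl hij
  nonneg _ := zero_le_one
  le_or_eq _ := h
  sum_le z := by
    rw [Finset.univ_unique, Finset.sum_singleton, one_mul]
    exact (D.tnorm_restrictTo_le E z).trans (le_mul_of_one_le_left (D.tnorm_nonneg z) hC)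

/-- The conclusion of the decomposition theorem: `‖E y‖` is dominated, up to `τ`, by the weighted
sum over a system of subsets of `E` with minima of complexity at most `R`. -/
def HasSystem (D : TsirelsonData) (ε C : ℝ) (R : ℕ) (E : Set ℕ+) (y : ℕ+ →₀ ℝ) (τ : ℝ) : Prop :=
  ∃ (ι : Type) (_ : Fintype ι) (F : ι → Set ℕ+) (f : ι → ℕ+) (w : ι → ℝ),
    D.IsSystem ε C F f w ∧ (∀ i, F i ⊆ E) ∧ Finset.univ.image f ∈ coverFamily R ∧
    D.tnorm (restrictTo E y) ≤ ∑ i, w i * D.tnorm (restrictTo (F i) y) + τ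

theorem hasSystem_of_nonpos {ε C τ : ℝ} (hC : 0 ≤ C) (R : ℕ) {E : Set ℕ+} {y : ℕ+ →₀ ℝ}
    (h : D.tnorm (restrictTo E y) ≤ τ) : D.HasSystem ε C R E y τ := by
  refine ⟨Empty, inferInstance, _, _, _, isSystem_empty hC, fun i => i.elim, ?_, ?_⟩
  · exact empty_mem_coverFamily R
  · simpa using h

theorem hasSystem_of_abs {ε C τ : ℝ} (hC : 1 ≤ C) {R : ℕ} (hR : 1 ≤ R) {E : Set ℕ+}
    {y : ℕ+ →₀ ℝ} {k : ℕ+} (h : D.tnorm (restrictTo E y) ≤ |restrictTo E y k| + τ) :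
    D.HasSystem ε C R E y τ := by
  by_cases hk : k ∈ E
  · refine ⟨Unit, inferInstance, fun _ => {k}, fun _ => k, _,
      isSystem_unit hC isLeast_singleton (Or.inr rfl), fun _ => by simpa using hk, ?_, ?_⟩
    · rw [Finset.univ_unique, Finset.image_singleton]
      exact coverFamily_mono hR (singleton_mem_coverFamily k)
    · rw [Finset.univ_unique, Finset.sum_singleton, one_mul]
      refine h.trans (add_le_add_left ?_ τ)
      rw [restrictTo_apply_of_mem hk, ← restrictTo_apply_of_mem (Set.mem_singleton k) y]
      exact (abs_le_czeroNorm _ k).trans (D.isIntermediateNorm_tnorm.czero_le _)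
  · refine hasSystem_of_nonpos (zero_le_one.trans hC) R ?_
    rwa [restrictTo_apply_of_notMem hk, abs_zero, zero_add] at h

theorem hasSystem_zero {ε C τ : ℝ} (hε : 1 ≤ ε) (hC : 1 ≤ C) (hτ : 0 ≤ τ) (E : Set ℕ+)
    (y : ℕ+ →₀ ℝ) : D.HasSystem ε C 1 E y τ := by
  rcases E.eq_empty_or_nonempty with rfl | hE
  · refine hasSystem_of_nonpos (zero_le_one.trans hC) 1 ?_
    rwa [restrictTo_eq_zero (by simp), D.tnorm_zero]
  · obtain ⟨a, ha⟩ := exists_isLeast_pnat hE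
    refine ⟨Unit, inferInstance, fun _ => E, fun _ => a, _, isSystem_unit hC ha (Or.inl hε),
      fun _ => Subset.rfl, ?_, ?_⟩
    · rw [Finset.univ_unique, Finset.image_singleton]
      exact singleton_mem_coverFamily a
    · rw [Finset.univ_unique, Finset.sum_singleton, one_mul]
      exact le_add_of_nonneg_right hτ

/-- The terminal step: the regrouped unions, cut down to `E`, all receive the weight `ε`. The
constant `θ_p⁻¹ ^ m` is the price of summing norms over a disjoint `S_m`-family. -/
theorem hasSystem_of_schreier {p : ℕ+} (hp : D.σ p = TsirelsonMode.M) {ε ε' τ : ℝ}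
    (hε : 0 ≤ ε) (hε1 : ε ≤ 1) (hεε' : ε ≤ ε') {m R : ℕ} (hR : m + 1 ≤ R) {E : Set ℕ+}
    {y : ℕ+ →₀ ℝ} {B : Finset ℕ+} (hB : B ∈ schreier m) {U : ℕ+ → Set ℕ+}
    (hU : ∀ b ∈ B, IsLeast (U b) b) (hsep : SeparatedOn TsirelsonMode.M B U id)
    (h : D.tnorm (restrictTo E y) ≤
      ε * ∑ b ∈ B, D.tnorm (restrictTo (U b) (restrictTo E y)) + τ) :
    D.HasSystem ε' ((D.θ p)⁻¹ ^ m) R E y τ := by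
  classical
  set B' := B.filter fun b => (U b ∩ E).Nonempty with hB'
  have hmem : ∀ b : B', (b : ℕ+) ∈ B ∧ (U b ∩ E).Nonempty := fun b =>
    Finset.mem_filter.mp b.2
  choose f hf using fun b : B' => exists_isLeast_pnat (hmem b).2
  refine ⟨B', inferInstance, fun b => U b ∩ E, f, fun _ => ε,
    ⟨hf, ?_, fun _ => hε, fun _ => Or.inl hεε', ?_⟩, fun _ => inter_subset_right, ?_, ?_⟩
  · intro b c hbc
    exact (hsep.1 b (hmem b).1 c (hmem c).1 fun h => hbc (Subtype.ext h)).mono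
      inter_subset_left inter_subset_left
  · intro z
    rw [← Finset.mul_sum]
    have h1 : ∑ b : B', D.tnorm (restrictTo (U b ∩ E) z) ≤
        ∑ b ∈ B, D.tnorm (restrictTo (U b) z) := by
      rw [Finset.sum_coe_sort B' fun b => D.tnorm (restrictTo (U b ∩ E) z)]
      refine (Finset.sum_le_sum fun b _ => ?_).trans
        (Finset.sum_le_sum_of_subset_of_nonneg (Finset.filter_subset _ _)
          fun b _ _ => D.tnorm_nonneg _)
      rw [inter_comm, ← restrictTo_restrictTo]
      exact D.tnorm_restrictTo_le _ _
    refine (mul_le_of_le_one_left (Finset.sum_nonneg fun b _ => D.tnorm_nonneg _) hε1).trans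
      (h1.trans ?_)
    exact D.sum_tnorm_le_of_schreier hp m (m := id) (J := B) (E := U) hU (by rwa [Finset.image_id]) hsep z
  -- Cutting down to `E` may move the minima. Each `b` carries at most one new minimum, which is at
  -- least `b`, so the total complexity is at most `m + 1`.
  · refine coverFamily_of_subset (coverFamily_mono hR (biUnion_mem_coverFamily m 1
      (J := B) (m := id) (Set.injOn_id _) (by rwa [Finset.image_id])
      (G := fun b => (Finset.univ.filter fun c : B' => (c : ℕ+) = b).image f) ?_ ?_)) ?_
    · intro b _
      by_cases hb : b ∈ B'
      · refine coverFamily_of_subset (singleton_mem_coverFamily (f ⟨b, hb⟩)) ?_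
        intro a ha
        obtain ⟨c, hc, rfl⟩ := Finset.mem_image.mp ha
        obtain rfl : c = ⟨b, hb⟩ := Subtype.ext (Finset.mem_filter.mp hc).2
        exact Finset.mem_singleton_self _
      · refine coverFamily_of_subset (empty_mem_coverFamily 1) ?_
        intro a ha
        obtain ⟨c, hc, rfl⟩ := Finset.mem_image.mp ha
        exact absurd ((Finset.mem_filter.mp hc).2 ▸ c.2) hb
    · intro b hb g hg
      obtain ⟨c, hc, rfl⟩ := Finset.mem_image.mp hg
      obtain rfl : (c : ℕ+) = b := (Finset.mem_filter.mp hc).2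
      exact (hU _ hb).2 (hf c).1.1
    · intro a ha
      obtain ⟨c, -, rfl⟩ := Finset.mem_image.mp ha
      exact Finset.mem_biUnion.mpr ⟨c, (hmem c).1, Finset.mem_image.mpr
        ⟨c, Finset.mem_filter.mpr ⟨Finset.mem_univ c, rfl⟩, rfl⟩⟩
  · refine h.trans (add_le_add_left (le_of_eq ?_) τ)
    rw [← Finset.mul_sum]
    congr 1
    rw [Finset.sum_coe_sort B' fun b => D.tnorm (restrictTo (U b ∩ E) y)]
    rw [Finset.sum_filter]
    refine Finset.sum_congr rfl fun b _ => ?_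
    rw [restrictTo_restrictTo]
    split_ifs with hb
    · rfl
    · rw [Set.not_nonempty_iff_eq_empty.mp hb, restrictTo_eq_zero (by simp), D.tnorm_zero]

/-- Systems on the members of an adapted family combine into one, with weights multiplied by `θ_n`.
The constant `C` does not grow, because `θ_n ∑ ‖A_j z‖ ≤ ‖z‖`; the complexity grows by `n`. -/
theorem hasSystem_of_adapted {n : ℕ+} {ε ε' C τ : ℝ} (hC : 0 ≤ C)
    (hεε' : D.θ n * ε ≤ ε') {r R : ℕ} (hR : n + r ≤ R) {E : Set ℕ+} {y : ℕ+ →₀ ℝ} {k : ℕ}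
    {A : Fin k → Set ℕ+} (hA : AdaptedFamily n (D.σ n) A) {τ₁ τ₂ : ℝ} (hτ : τ₁ + k * τ₂ ≤ τ)
    (hτ₂ : 0 ≤ τ₂)
    (h : D.tnorm (restrictTo E y) ≤
      D.θ n * ∑ i, D.tnorm (restrictTo (A i) (restrictTo E y)) + τ₁)
    (hsys : ∀ j, D.HasSystem ε C r (A j ∩ E) y τ₂) : D.HasSystem ε' C R E y τ := by
  classical
  obtain ⟨m, hm, hS⟩ := hA.1
  have hsep := hA.separatedOn hm
  have hθ := D.θ_mem n
  choose ι hι F f w hs hsub hcov hle using hsys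
  refine ⟨Σ j, ι j, inferInstance, fun i => F i.1 i.2, fun i => f i.1 i.2,
    fun i => D.θ n * w i.1 i.2, ⟨fun i => (hs i.1).least i.2, ?_,
      fun i => mul_nonneg hθ.1.le ((hs i.1).nonneg i.2), ?_, ?_⟩, ?_, ?_, ?_⟩
  · rintro ⟨i, a⟩ ⟨j, b⟩ hij
    by_cases h : i = j
    · subst h
      exact (hs i).disj a b fun h => hij (by rw [h])
    · exact (hA.disjoint i j h).mono ((hsub i a).trans inter_subset_left)
        ((hsub j b).trans inter_subset_left)
  · rintro ⟨i, a⟩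
    rcases (hs i).le_or_eq a with h | h
    · exact Or.inl ((mul_le_mul_of_nonneg_left h hθ.1.le).trans hεε')
    · exact Or.inr h
  · intro z
    rw [Fintype.sum_sigma]
    have h1 : ∀ j, ∑ a, D.θ n * w j a * D.tnorm (restrictTo (F j a) z) ≤
        D.θ n * (C * D.tnorm (restrictTo (A j) z)) := by
      intro j
      simp_rw [mul_assoc]
      rw [← Finset.mul_sum]
      refine mul_le_mul_of_nonneg_left ?_ hθ.1.le
      refine le_trans (le_of_eq ?_) ((hs j).sum_le (restrictTo (A j) z))
      refine Finset.sum_congr rfl fun a _ => ?_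
      rw [restrictTo_restrictTo_of_subset ((hsub j a).trans inter_subset_left)]
    refine (Finset.sum_le_sum fun j _ => h1 j).trans ?_
    rw [← Finset.mul_sum, ← Finset.mul_sum, mul_left_comm]
    exact mul_le_mul_of_nonneg_left
      (D.mul_sum_tnorm_le (J := Finset.univ) (fun i _ => hm i) hS hsep z) hC
  · exact fun i => (hsub i.1 i.2).trans inter_subset_right
  · refine coverFamily_of_subset (coverFamily_mono hR (biUnion_mem_coverFamily n r
      (hsep.injOn fun i _ => hm i) hS (G := fun j => Finset.univ.image (f j))
      (fun j _ => hcov j) ?_)) ?_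
    · intro j _ g hg
      obtain ⟨a, -, rfl⟩ := Finset.mem_image.mp hg
      exact (hm j).2 (hsub j a ((hs j).least a).1).1
    · intro g hg
      obtain ⟨⟨j, a⟩, -, rfl⟩ := Finset.mem_image.mp hg
      exact Finset.mem_biUnion.mpr ⟨j, Finset.mem_univ j,
        Finset.mem_image_of_mem _ (Finset.mem_univ a)⟩
  · have h1 : ∑ j, D.tnorm (restrictTo (A j) (restrictTo E y)) ≤
        ∑ j, (∑ a, w j a * D.tnorm (restrictTo (F j a) y) + τ₂) := by
      refine Finset.sum_le_sum fun j _ => ?_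
      rw [restrictTo_restrictTo]
      exact hle j
    rw [Finset.sum_add_distrib, Finset.sum_const, Finset.card_univ, Fintype.card_fin,
      nsmul_eq_mul] at h1
    rw [Fintype.sum_sigma]
    simp_rw [mul_assoc, ← Finset.mul_sum]
    have h2 := mul_le_mul_of_nonneg_left h1 hθ.1.le
    have h3 : D.θ n * (k * τ₂) ≤ k * τ₂ := mul_le_of_le_one_left (by positivity) hθ.2.le
    linarith

/-- Iteration of the implicit equation of the norm, which stops at families of high order. -/
theorem hasSystem {p : ℕ+} (hp : D.σ p = TsirelsonMode.M) {t ε : ℝ} (ht : 0 ≤ t) (hε : 0 ≤ ε)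
    (hε1 : ε ≤ 1) {q : ℕ} {m : ℕ+} (hmq : m ≤ q) (hlow : ∀ n : ℕ+, (n : ℕ) ≤ q → D.θ n ≤ t)
    (hhigh : ∀ n : ℕ+, q < (m + n : ℕ) → D.eta m n < ε) (L : ℕ) (E : Set ℕ+) (y : ℕ+ →₀ ℝ)
    {τ : ℝ} (hτ : 0 < τ) :
    D.HasSystem (max (t ^ L) ε) ((D.θ p)⁻¹ ^ (m : ℕ)) (L * q + 1) E y τ := by
  have hC : 1 ≤ (D.θ p)⁻¹ ^ (m : ℕ) :=
    one_le_pow₀ ((one_le_inv₀ (D.θ_mem p).1).mpr (D.θ_mem p).2.le)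
  induction L generalizing E τ with
  | zero =>
    rw [zero_mul, zero_add]
    -- The bound on the weights is at least `t ^ 0 = 1`, so `E` itself with weight `1` is a system.
    exact hasSystem_zero (by simp) hC hτ.le E y
  | succ L ih =>
    rcases D.exists_abs_or_adapted (restrictTo E y) (half_pos hτ) with ⟨k, hk⟩ | ⟨n, k, A, hA, h⟩
    · exact hasSystem_of_abs hC (by omega) (hk.trans (add_le_add_right (by linarith) _))
    rcases le_or_gt (n : ℕ) q with hn | hn
    -- Low order: a factor `θ_n ≤ t` is gained, and the `k` pieces share half of the error.
    · refine hasSystem_of_adapted (τ₁ := τ / 2) (τ₂ := τ / 2 / (k + 1))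
        (ε := max (t ^ L) ε) (r := L * q + 1) (zero_le_one.trans hC) ?_ ?_ hA ?_
        (by positivity) h fun j => ih _ (by positivity)
      · rw [mul_max_of_nonneg _ _ (D.θ_mem n).1.le, pow_succ']
        refine max_le_max ?_ ?_
        · exact mul_le_mul_of_nonneg_right (hlow n hn) (by positivity)
        · exact mul_le_of_le_one_left hε (D.θ_mem n).2.le
      · rw [Nat.succ_mul]; omega
      · have : (k : ℝ) * (τ / 2 / (k + 1)) ≤ τ / 2 := by
          rw [mul_div_left_comm]
          refine mul_le_of_le_one_right (by positivity) ?_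
          rw [div_le_one (by positivity)]
          linarith
        linarith
    -- High order: regrouping gives weight `ε` at once.
    · obtain ⟨n', rfl⟩ : ∃ n', m + n' = n :=
        ⟨n - m, PNat.add_sub_of_lt (by rw [← PNat.coe_lt_coe]; omega)⟩
      obtain ⟨μ, hμ, hS⟩ := hA.1
      obtain ⟨B, hB, U, hU, hsep, hle⟩ := D.exists_regroup_of_eta_lt (hhigh n' (by simpa using hn))
        (J := Finset.univ) (fun i _ => hμ i) hS (hA.separatedOn hμ) (restrictTo E y)
      refine hasSystem_of_schreier hp hε hε1 (le_max_right _ _) (m := m) ?_ hB hU hsep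
        (h.trans (by linarith))
      rw [Nat.succ_mul]
      omega

end TsirelsonData

/-! ### Derived trees -/

section Trees

variable {B : Type u} {T : Set (List B)}

theorem iterDerivedTree_zero (T : Set (List B)) : iterDerivedTree T 0 = T :=
  Ordinal.limitRecOn_zero _ _ _

theorem iterDerivedTree_add_one (T : Set (List B)) (α : Ordinal.{u}) :
    iterDerivedTree T (α + 1) = derivedTree (iterDerivedTree T α) :=
  Ordinal.limitRecOn_add_one _ _ _ _

theorem mem_iterDerivedTree_limit {β : Ordinal.{u}} (hβ : Order.IsSuccLimit β) {s : List B} :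
    s ∈ iterDerivedTree T β ↔ ∀ γ < β, s ∈ iterDerivedTree T γ := by
  have h : iterDerivedTree T β = ⋂ (γ : Ordinal.{u}) (_ : γ < β), iterDerivedTree T γ :=
    Ordinal.limitRecOn_limit _ _ _ _ hβ
  rw [h, Set.mem_iInter₂]

theorem IsSeqTree.iterDerivedTree (hT : IsSeqTree T) (α : Ordinal.{u}) :
    IsSeqTree (iterDerivedTree T α) := by
  induction α using Ordinal.limitRecOn with
  | zero => rwa [iterDerivedTree_zero]
  | add_one α ih =>
    rw [iterDerivedTree_add_one]
    refine ⟨fun s hs => hs.1, fun s x hs hsx => ⟨hs, x, ?_⟩⟩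
    obtain ⟨h1, y, hy⟩ := hsx
    exact ih.of_append _ _ h1 hy
  | limit β hβ ih =>
    refine ⟨fun s hs => ?_, fun s x hs hsx => ?_⟩
    · exact (ih 0 hβ.bot_lt).ne_nil s ((mem_iterDerivedTree_limit hβ).mp hs 0 hβ.bot_lt)
    · rw [mem_iterDerivedTree_limit hβ] at hsx ⊢
      exact fun γ hγ => (ih γ hγ).of_append s x hs (hsx γ hγ)

theorem IsSeqTree.antitone_iterDerivedTree (hT : IsSeqTree T) :
    Antitone (_root_.iterDerivedTree T) := by
  intro α β hαβ
  induction β using Ordinal.limitRecOn with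
  | zero => rw [nonpos_iff_eq_zero.mp hαβ]
  | add_one β ih =>
    rcases hαβ.eq_or_lt with rfl | h
    · exact le_rfl
    · refine le_trans ?_ (ih (Order.lt_add_one_iff.mp h))
      rw [iterDerivedTree_add_one]
      rintro s ⟨hs, x, hx⟩
      exact (hT.iterDerivedTree β).of_append s x hs hx
  | limit β hβ ih =>
    rcases hαβ.eq_or_lt with rfl | h
    · exact le_rfl
    · exact fun s hs => (mem_iterDerivedTree_limit hβ).mp hs α h

theorem exists_append_mem_iterDerivedTree {γ : Ordinal.{u}} (n : ℕ) {s : List B}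
    (hs : s ∈ iterDerivedTree T (γ + n)) : ∃ u, u.length = n ∧ s ++ u ∈ iterDerivedTree T γ := by
  induction n generalizing s with
  | zero => exact ⟨[], rfl, by simpa using hs⟩
  | succ n ih =>
    rw [Nat.cast_succ, ← add_assoc, iterDerivedTree_add_one] at hs
    obtain ⟨-, x, hx⟩ := hs
    obtain ⟨u, hu, hsu⟩ := ih hx
    exact ⟨x :: u, by rw [List.length_cons, hu], by simpa using hsu⟩

end Trees

/-! ### Linear combinations of the members of a list -/

section Combinations

variable {B : Type u} [NormedAddCommGroup B] [NormedSpace ℝ B]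

/-- `v` is a linear combination of the members of a list whose coefficients have the sum `r` of
absolute values. -/
inductive IsCombination : List B → B → ℝ → Prop
  | nil : IsCombination [] 0 0
  | cons (x : B) (c : ℝ) {u : List B} {v : B} {r : ℝ} :
      IsCombination u v r → IsCombination (x :: u) (c • x + v) (|c| + r)

theorem IsCombination.append {u u' : List B} {v v' : B} {r r' : ℝ} (h : IsCombination u v r)
    (h' : IsCombination u' v' r') : IsCombination (u ++ u') (v + v') (r + r') := by
  induction h with
  | nil => simpa using h'
  | cons x c _ ih =>
    rw [add_assoc, add_assoc, List.cons_append]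
    exact ih.cons x c

theorem IsCombination.smul {u : List B} {v : B} {r : ℝ} (h : IsCombination u v r) {t : ℝ}
    (ht : 0 ≤ t) : IsCombination u (t • v) (t * r) := by
  induction h with
  | nil => simpa using IsCombination.nil
  | cons x c _ ih =>
    rw [smul_add, smul_smul, mul_add, ← abs_of_nonneg ht, ← abs_mul, abs_of_nonneg ht]
    exact ih.cons x _

theorem isCombination_zero (u : List B) : IsCombination u 0 0 := by
  induction u with
  | nil => exact .nil
  | cons x u ih => simpa using ih.cons x 0

theorem isCombination_sum (u : List B) (c : Fin u.length → ℝ) :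
    IsCombination u (∑ i, c i • u.get i) (∑ i, |c i|) := by
  induction u with
  | nil => simpa using IsCombination.nil
  | cons x u ih =>
    have := (ih fun i => c i.succ).cons x (c 0)
    convert this using 1
    · exact Fin.sum_univ_succ (n := u.length) _
    · exact Fin.sum_univ_succ (n := u.length) _

theorem IsCombination.exists_coeff {u : List B} {v : B} {r : ℝ} (h : IsCombination u v r) :
    ∃ c : Fin u.length → ℝ, ∑ i, |c i| = r ∧ ∑ i, c i • u.get i = v := by
  induction h with
  | nil => exact ⟨fun _ => 0, by simp, by simp⟩
  | @cons x c u v r _ ih =>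
    obtain ⟨d, rfl, rfl⟩ := ih
    refine ⟨Fin.cons c d, ?_, ?_⟩
    · exact (Fin.sum_univ_succ (n := u.length) _).trans (by simp)
    · exact (Fin.sum_univ_succ (n := u.length) _).trans (by simp)

theorem IsEllOneTree.le_norm {K : ℝ} {T : Set (List B)} (hT : IsEllOneTree B K T) {s : List B}
    (hs : s ∈ T) {v : B} {r : ℝ} (hv : IsCombination s v r) : K⁻¹ * r ≤ ‖v‖ := by
  obtain ⟨c, rfl, rfl⟩ := hv.exists_coeff
  exact (hT.2 s hs).2 c

end Combinations

/-! ### Finitely supported approximation and block averages. -/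

namespace TsirelsonData

variable (D : TsirelsonData)

/-- The inclusion of the finitely supported sequences. -/
noncomputable def embed : (ℕ+ →₀ ℝ) →ₗ[ℝ] D.Space :=
  (UniformSpace.Completion.toComplₗᵢ (𝕜 := ℝ) (E := D.FinSeq)).toLinearMap

theorem norm_embed (x : ℕ+ →₀ ℝ) : ‖D.embed x‖ = D.tnorm x :=
  UniformSpace.Completion.norm_coe (E := D.FinSeq) x

theorem exists_embed_near (v : D.Space) {δ : ℝ} (hδ : 0 < δ) : ∃ x, ‖v - D.embed x‖ ≤ δ := by
  obtain ⟨x, hx⟩ := UniformSpace.Completion.denseRange_coe (α := D.FinSeq).exists_dist_lt v hδ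
  rw [dist_eq_norm] at hx
  exact ⟨x, hx.le⟩

/-- Finitely supported vectors that behave as averages of successive vectors in the intervals
`(N, M]`; `μ G` is the weight of the intervals that are hit by `G`. -/
structure IsBlockAverage (ε C κ : ℝ) (N M : ℕ) (y : ℕ+ →₀ ℝ) (μ : Finset ℕ+ → ℝ) (ρ : ℝ) :
    Prop where
  sum_le : ∀ (ι : Type) [Fintype ι] (F : ι → Set ℕ+) (f : ι → ℕ+) (w : ι → ℝ),
    D.IsSystem ε C F f w → ∑ i, w i * D.tnorm (restrictTo (F i) y) ≤
      κ * ρ + 2 * C * μ (Finset.univ.image f)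
  le : ∀ G, μ G ≤ ρ
  cover : ∀ (G : Finset ℕ+) (l : List (Finset ℕ+)),
    (∀ g ∈ G, N < (g : ℕ) → (g : ℕ) ≤ M → ∃ A ∈ l, g ∈ A) → μ G ≤ (l.map μ).sum

variable {D}

theorem isBlockAverage_zero (ε C κ : ℝ) (N M : ℕ) :
    D.IsBlockAverage ε C κ N M 0 (fun _ => 0) 0 where
  sum_le ι _ F f w _ := by
    simp [restrictTo_eq_zero (x := 0), D.tnorm_zero]
  le _ := le_rfl
  cover _ l _ := by simp

theorem IsBlockAverage.add {ε C κ : ℝ} {N M N' M' : ℕ} {y y' : ℕ+ →₀ ℝ}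
    {μ μ' : Finset ℕ+ → ℝ} {ρ ρ' : ℝ} (h : D.IsBlockAverage ε C κ N M y μ ρ)
    (h' : D.IsBlockAverage ε C κ N' M' y' μ' ρ') (hN : N ≤ N') (hM : M ≤ M') :
    D.IsBlockAverage ε C κ N M' (y + y') (fun G => μ G + μ' G) (ρ + ρ') where
  sum_le ι _ F f w hw := by
    have h1 := h.sum_le ι F f w hw
    have h2 := h'.sum_le ι F f w hw
    have h3 : ∑ i, w i * D.tnorm (restrictTo (F i) (y + y')) ≤
        ∑ i, w i * D.tnorm (restrictTo (F i) y) + ∑ i, w i * D.tnorm (restrictTo (F i) y') := by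
      rw [← Finset.sum_add_distrib]
      refine Finset.sum_le_sum fun i _ => ?_
      rw [← mul_add, restrictTo_add]
      exact mul_le_mul_of_nonneg_left (D.isIntermediateNorm_tnorm.add_le _ _) (hw.nonneg i)
    linarith
  le G := add_le_add (h.le G) (h'.le G)
  cover G l hl := by
    rw [List.sum_map_add]
    exact add_le_add (h.cover G l fun g hg h1 h2 => hl g hg h1 (h2.trans hM))
      (h'.cover G l fun g hg h1 h2 => hl g hg (hN.trans_lt h1) h2)

theorem IsBlockAverage.smul {ε C κ : ℝ} {N M : ℕ} {y : ℕ+ →₀ ℝ} {μ : Finset ℕ+ → ℝ} {ρ : ℝ}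
    (h : D.IsBlockAverage ε C κ N M y μ ρ) {t : ℝ} (ht : 0 ≤ t) :
    D.IsBlockAverage ε C κ N M (t • y) (fun G => t * μ G) (t * ρ) where
  sum_le ι _ F f w hw := by
    have h1 := mul_le_mul_of_nonneg_left (h.sum_le ι F f w hw) ht
    have h3 : ∑ i, w i * D.tnorm (restrictTo (F i) (t • y)) ≤
        t * ∑ i, w i * D.tnorm (restrictTo (F i) y) := by
      rw [Finset.mul_sum]
      refine Finset.sum_le_sum fun i _ => ?_
      rw [restrictTo_smul, mul_left_comm]
      refine mul_le_mul_of_nonneg_left ?_ (hw.nonneg i)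
      exact (D.isIntermediateNorm_tnorm.smul_le _ _).trans_eq (by rw [abs_of_nonneg ht])
    linarith
  le G := mul_le_mul_of_nonneg_left (h.le G) ht
  cover G l hl := by
    rw [List.sum_map_mul_left]
    exact mul_le_mul_of_nonneg_left (h.cover G l hl) ht

/-- The sets of a system that begin before a vector, and are not singletons, are few. -/
theorem IsSystem.sum_le_of_forall_notMem {p : ℕ+} (hp : D.σ p = TsirelsonMode.M) {ε C : ℝ}
    (hε : 0 ≤ ε) {ι : Type} [Fintype ι] {F : ι → Set ℕ+} {f : ι → ℕ+} {w : ι → ℝ}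
    (hw : D.IsSystem ε C F f w) {N M : ℕ} {z : ℕ+ →₀ ℝ}
    (hz : ∀ k, z k ≠ 0 → N < (k : ℕ) ∧ (k : ℕ) ≤ M) (hf : ∀ i, N < (f i : ℕ) → M < f i) :
    ∑ i, w i * D.tnorm (restrictTo (F i) z) ≤ ε * (D.θ p)⁻¹ * D.tnorm z := by
  classical
  set V : Set ℕ+ := {k | N < (k : ℕ)} with hV
  set J : Finset ι := Finset.univ.filter fun i => (f i : ℕ) ≤ N ∧ (F i ∩ V).Nonempty with hJ
  have hmem : ∀ i, i ∈ J ↔ (f i : ℕ) ≤ N ∧ (F i ∩ V).Nonempty := fun i => by simp [hJ]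
  have hzero : ∀ i, i ∉ J → D.tnorm (restrictTo (F i) z) = 0 := by
    intro i hi
    rw [restrictTo_eq_zero, D.tnorm_zero]
    intro k hk
    by_contra hzk
    obtain ⟨h1, h2⟩ := hz k hzk
    refine hi ((hmem i).mpr ⟨?_, k, hk, h1⟩)
    by_contra h3
    have h4 : f i ≤ k := (hw.least i).2 hk
    have h5 : (f i : ℕ) ≤ k := h4
    have := hf i (by omega)
    omega
  have hne : ∀ i : ι, ∃ a, i ∈ J → IsLeast (F i ∩ V) a := by
    intro i
    by_cases hi : i ∈ J
    · obtain ⟨a, ha⟩ := exists_isLeast_pnat ((hmem i).mp hi).2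
      exact ⟨a, fun _ => ha⟩
    · exact ⟨1, fun h => absurd h hi⟩
  choose m hm using hne
  have hdisj : ∀ i ∈ J, ∀ j ∈ J, i ≠ j → Disjoint (F i ∩ V) (F j ∩ V) := fun i _ j _ hij =>
    (hw.disj i j hij).mono inter_subset_left inter_subset_left
  -- The minima `f i`, `i ∈ J`, are distinct points of `{1, …, N}`, while the traces on `V` begin
  -- beyond `N`; so the minima of the traces form an `S_1`-set.
  have hcard : J.card ≤ N := by
    have hinj : Set.InjOn (fun i => (f i : ℕ)) (J : Set ι) := by
      intro i _ j _ hij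
      by_contra hne
      refine Set.disjoint_left.mp (hw.disj i j hne) (hw.least i).1 ?_
      rw [PNat.coe_injective hij]
      exact (hw.least j).1
    rw [← Finset.card_image_of_injOn hinj, show N = (Finset.Icc 1 N).card by simp]
    refine Finset.card_le_card fun a ha => ?_
    obtain ⟨i, hi, rfl⟩ := Finset.mem_image.mp ha
    exact Finset.mem_Icc.mpr ⟨(f i).pos, ((hmem i).mp hi).1⟩
  have hS : J.image m ∈ schreier p := by
    refine schreier_mono p.pos ?_
    change J.image m ∈ schreier 1
    rw [schreier_one]
    intro a ha
    obtain ⟨i, hi, rfl⟩ := Finset.mem_image.mp ha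
    have : N < (m i : ℕ) := (hm i hi).1.2
    exact Finset.card_image_le.trans (hcard.trans this.le)
  have hsep : SeparatedOn (D.σ p) J (fun i => F i ∩ V) m :=
    ⟨hdisj, fun h => by rw [hp] at h; cases h⟩
  have hle := D.mul_sum_tnorm_le hm hS hsep z
  rw [← le_inv_mul_iff₀ (D.θ_mem p).1] at hle
  have hcongr : ∀ i, restrictTo (F i ∩ V) z = restrictTo (F i) z := fun i =>
    restrictTo_congr fun k hk => ⟨fun h => h.1, fun h => ⟨h, (hz k hk).1⟩⟩
  calc ∑ i, w i * D.tnorm (restrictTo (F i) z)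
      = ∑ i ∈ J, w i * D.tnorm (restrictTo (F i) z) := by
        symm
        refine Finset.sum_subset (Finset.subset_univ _) fun i _ hi => ?_
        rw [hzero i hi, mul_zero]
    _ ≤ ∑ i ∈ J, ε * D.tnorm (restrictTo (F i ∩ V) z) := by
        refine Finset.sum_le_sum fun i hi => ?_
        rw [hcongr]
        rcases hw.le_or_eq i with h | h
        · exact mul_le_mul_of_nonneg_right h (D.tnorm_nonneg _)
        -- A singleton cannot begin at or before `N` and still reach beyond `N`.
        · obtain ⟨h1, k, hk, hkN⟩ := (hmem i).mp hi
          rw [h, Set.mem_singleton_iff] at hk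
          rw [hk] at hkN
          exact absurd hkN (not_lt.mpr h1)
    _ ≤ ε * (D.θ p)⁻¹ * D.tnorm z := by
        rw [← Finset.mul_sum, mul_assoc]
        exact mul_le_mul_of_nonneg_left hle hε

/-- The weight is the indicator of meeting `(N, M]`. If a minimum falls there, the system constant
gives `C ‖z‖ ≤ 2 C`; otherwise only the few sets beginning before the block count. -/
theorem exists_isBlockAverage_single {p : ℕ+} (hp : D.σ p = TsirelsonMode.M) {ε C : ℝ}
    (hε : 0 ≤ ε) (hC : 0 ≤ C) {N M : ℕ} {z : ℕ+ →₀ ℝ} (hz2 : D.tnorm z ≤ 2)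
    (hz : ∀ k, z k ≠ 0 → N < (k : ℕ) ∧ (k : ℕ) ≤ M) :
    ∃ μ, D.IsBlockAverage ε C (2 * ε * (D.θ p)⁻¹) N M z μ 1 := by
  classical
  have hθ := (D.θ_mem p).1
  refine ⟨fun G => if ∃ g ∈ G, N < (g : ℕ) ∧ (g : ℕ) ≤ M then 1 else 0, ⟨?_, ?_, ?_⟩⟩
  · intro ι _ F f w hw
    split_ifs with h
    · have h1 := hw.sum_le z
      have h2 : C * D.tnorm z ≤ C * 2 := mul_le_mul_of_nonneg_left hz2 hC
      have h3 : 0 ≤ 2 * ε * (D.θ p)⁻¹ := by positivity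
      linarith
    · have h1 := hw.sum_le_of_forall_notMem hp hε hz fun i hi => by
        by_contra hn
        exact h ⟨f i, Finset.mem_image_of_mem f (Finset.mem_univ i), hi, not_lt.mp hn⟩
      have h2 : ε * (D.θ p)⁻¹ * D.tnorm z ≤ ε * (D.θ p)⁻¹ * 2 :=
        mul_le_mul_of_nonneg_left hz2 (by positivity)
      linarith
  · intro G
    split_ifs <;> norm_num
  · intro G l hl
    have hnn : ∀ a ∈ l.map fun G : Finset ℕ+ =>
        if ∃ g ∈ G, N < (g : ℕ) ∧ (g : ℕ) ≤ M then (1 : ℝ) else 0, 0 ≤ a := by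
      intro a ha
      obtain ⟨A, -, rfl⟩ := List.mem_map.mp ha
      split_ifs <;> norm_num
    by_cases h : ∃ g ∈ G, N < (g : ℕ) ∧ (g : ℕ) ≤ M
    · rw [if_pos h]
      obtain ⟨g, hg, h1, h2⟩ := h
      obtain ⟨A, hA, hgA⟩ := hl g hg h1 h2
      refine List.single_le_sum hnn 1 (List.mem_map.mpr ⟨A, hA, ?_⟩)
      rw [if_pos ⟨g, hgA, h1, h2⟩]
    · rw [if_neg h]
      exact List.sum_nonneg hnn

end TsirelsonData

/-! ### Averages below nodes of high rank, and the upper bound. -/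

namespace TsirelsonData

variable {D : TsirelsonData}

/-- More than `N` vectors have a nontrivial combination annihilated by the first `N` coordinates. It
is taken of the finitely supported approximants, and the same coefficients, normalized in ℓ¹, are
used in the original vectors. -/
theorem exists_combination_vanishing {u : List D.Space} (hu : ∀ x ∈ u, ‖x‖ = 1) {N : ℕ}
    (hN : N < u.length) {δ : ℝ} (hδ : 0 < δ) (hδ1 : δ ≤ 1) :
    ∃ v z, IsCombination u v 1 ∧ ‖v - D.embed z‖ ≤ δ ∧ D.tnorm z ≤ 2 ∧
      ∀ k, z k ≠ 0 → N < (k : ℕ) := by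
  choose x hx using fun i : Fin u.length => D.exists_embed_near (u.get i) hδ
  let Φ : (Fin u.length → ℝ) →ₗ[ℝ] (Fin N → ℝ) := LinearMap.pi fun j =>
    (Finsupp.lapply (Nat.succPNat j)).comp (Fintype.linearCombination ℝ x)
  have hker : Φ.ker ≠ ⊥ := LinearMap.ker_ne_bot_of_finrank_lt (by simpa using hN)
  obtain ⟨c, hc, hc0⟩ := Submodule.exists_mem_ne_zero_of_ne_bot hker
  have hΦ : ∀ k : ℕ+, (k : ℕ) ≤ N → (∑ i, c i • x i) k = 0 := by
    intro k hk
    have h1 := congrFun (LinearMap.mem_ker.mp hc) ⟨k.natPred, by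
      have := k.natPred_add_one; omega⟩
    simpa [Φ, Fintype.linearCombination_apply, PNat.succPNat_natPred] using h1
  set S := ∑ i, |c i| with hS
  have hSpos : 0 < S := by
    obtain ⟨i, hi⟩ := Function.ne_iff.mp hc0
    exact (abs_pos.mpr hi).trans_le
      (Finset.single_le_sum (f := fun i => |c i|) (fun _ _ => abs_nonneg _) (Finset.mem_univ i))
  have hcomb := (isCombination_sum u c).smul (inv_nonneg.mpr hSpos.le)
  rw [← hS, inv_mul_cancel₀ hSpos.ne'] at hcomb
  have hbound : ∀ (f : Fin u.length → D.Space) (b : ℝ), (∀ i, ‖f i‖ ≤ b) →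
      ‖S⁻¹ • ∑ i, c i • f i‖ ≤ b := by
    intro f b hf
    rw [norm_smul, norm_inv, Real.norm_of_nonneg hSpos.le, inv_mul_le_iff₀ hSpos, hS,
      Finset.sum_mul]
    refine norm_sum_le_of_le _ fun i _ => ?_
    rw [norm_smul, Real.norm_eq_abs]
    exact mul_le_mul_of_nonneg_left (hf i) (abs_nonneg _)
  refine ⟨_, S⁻¹ • ∑ i, c i • x i, hcomb, ?_, ?_, ?_⟩
  · rw [map_smul, map_sum, ← smul_sub, ← Finset.sum_sub_distrib]
    simp_rw [map_smul, ← smul_sub]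
    exact hbound _ δ hx
  · rw [← norm_embed, map_smul, map_sum]
    simp_rw [map_smul]
    refine hbound _ 2 fun i => ?_
    have h1 := norm_sub_norm_le (D.embed (x i)) (u.get i)
    rw [norm_sub_rev, hu _ (List.get_mem u i)] at h1
    have := hx i
    linarith
  · intro k hk
    by_contra hn
    apply hk
    rw [Finsupp.smul_apply, hΦ k (not_lt.mp hn), smul_zero]

/-- Averages of complexity `R` can be found below the nodes of sufficiently high rank. -/
def HasAverages (D : TsirelsonData) (T : Set (List D.Space)) (ε C κ : ℝ) (R : ℕ) : Prop :=
  ∀ (γ : Ordinal.{0}) (s : List D.Space) (N : ℕ) (δ : ℝ), 0 < δ → δ ≤ 1 →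
    s ∈ iterDerivedTree T (γ + ω ^ ((R : Ordinal.{0}) + 1)) →
    ∃ u v M y μ, s ++ u ∈ iterDerivedTree T γ ∧ IsCombination u v 1 ∧ N ≤ M ∧
      ‖v - D.embed y‖ ≤ δ ∧ D.IsBlockAverage ε C κ N M y μ 1 ∧ ∀ G ∈ coverFamily R, μ G ≤ δ

theorem hasAverages_zero {T : Set (List D.Space)} (hT : IsSeqTree T)
    (hT1 : ∀ s ∈ T, ∀ x ∈ s, ‖x‖ = 1) {p : ℕ+} (hp : D.σ p = TsirelsonMode.M) {ε C : ℝ}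
    (hε : 0 ≤ ε) (hC : 0 ≤ C) : D.HasAverages T ε C (2 * ε * (D.θ p)⁻¹) 0 := by
  intro γ s N δ hδ hδ1 hs
  rw [Nat.cast_zero, zero_add, Ordinal.opow_one] at hs
  -- Rank `γ + ω` leaves room for the `N + 1` vectors required, whatever `N` is.
  have hs' : s ∈ iterDerivedTree T (γ + (N + 1 : ℕ)) :=
    hT.antitone_iterDerivedTree (add_le_add_right (Ordinal.natCast_lt_omega0 _).le γ) hs
  obtain ⟨u, hu, hsu⟩ := exists_append_mem_iterDerivedTree _ hs'
  have hmem : s ++ u ∈ T := by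
    have := hT.antitone_iterDerivedTree (zero_le (a := γ)) hsu
    rwa [iterDerivedTree_zero] at this
  obtain ⟨v, z, h1, h2, h3, h4⟩ := exists_combination_vanishing (u := u) (N := N)
    (fun x hx => hT1 _ hmem x (List.mem_append_right s hx)) (by omega) hδ hδ1
  set M := max N (z.support.sup fun k => (k : ℕ)) with hM
  have hz : ∀ k, z k ≠ 0 → N < (k : ℕ) ∧ (k : ℕ) ≤ M := fun k hk =>
    ⟨h4 k hk, le_max_of_le_right
      (Finset.le_sup (f := fun k : ℕ+ => (k : ℕ)) (Finsupp.mem_support_iff.mpr hk))⟩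
  obtain ⟨μ, hμ⟩ := exists_isBlockAverage_single hp hε hC h3 hz
  refine ⟨u, v, M, z, μ, hsu, h1, le_max_left _ _, h2, hμ, ?_⟩
  rintro G rfl
  exact (hμ.cover ∅ [] (by simp)).trans (by simpa using hδ.le)

/-- The first average that `G` meets may carry full weight `1`. All later ones are chosen so flat,
relative to the end of the preceding support, that `G` has weight at most `δ` on each. -/
theorem HasAverages.exists_sum {T : Set (List D.Space)} {ε C κ : ℝ} {R : ℕ}
    (h : D.HasAverages T ε C κ R) (n : ℕ) (γ : Ordinal.{0}) (s : List D.Space) (N : ℕ) {δ : ℝ}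
    (hδ : 0 < δ) (hδ1 : δ ≤ 1) (hs : s ∈ iterDerivedTree T (γ + ω ^ ((R : Ordinal.{0}) + 1) * n)) :
    ∃ u v M y μ, s ++ u ∈ iterDerivedTree T γ ∧ IsCombination u v n ∧ N ≤ M ∧
      ‖v - D.embed y‖ ≤ n * δ ∧ D.IsBlockAverage ε C κ N M y μ n ∧
      ∀ G ∈ coverFamily (R + 1), μ G ≤ 1 + n * δ := by
  induction n generalizing γ with
  | zero =>
    refine ⟨[], 0, N, 0, _, by simpa using hs, by simpa using IsCombination.nil, le_rfl,
      by simp, by simpa using isBlockAverage_zero ε C κ N N, by simp⟩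
  | succ n ih =>
    -- With the summand `ω ^ (R + 1)` in front, the first `n` averages end at a node of rank `γ + ω
    -- ^ (R + 1)`, enough for one more.
    rw [Nat.add_comm n 1, Nat.cast_add, Nat.cast_one, mul_add, mul_one, ← add_assoc] at hs
    obtain ⟨u, v, M, y, μ, hsu, hv, hNM, hvy, hμ, hcov⟩ := ih _ hs
    set δ' := δ / (M + 1) with hδ'
    have hδ'0 : 0 < δ' := by positivity
    have hδ'le : δ' ≤ δ := div_le_self hδ.le (by linarith [Nat.cast_nonneg (α := ℝ) M])
    have hMδ' : M * δ' ≤ δ := by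
      rw [hδ', mul_div_left_comm]
      refine mul_le_of_le_one_right hδ.le ?_
      rw [div_le_one (by positivity)]
      linarith
    obtain ⟨u', v', M', y', μ', hsu', hv', hMM', hvy', hμ', hcov'⟩ :=
      h γ (s ++ u) M δ' hδ'0 (hδ'le.trans hδ1) hsu
    refine ⟨u ++ u', v + v', M', y + y', fun G => μ G + μ' G, by rwa [← List.append_assoc], ?_, hNM.trans hMM', ?_,
      ?_, ?_⟩
    · rw [Nat.cast_succ]
      exact hv.append hv'
    · rw [map_add, add_sub_add_comm, Nat.cast_succ, add_mul, one_mul]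
      exact (norm_add_le _ _).trans (add_le_add hvy (hvy'.trans hδ'le))
    · rw [Nat.cast_succ]
      exact hμ.add hμ' hNM hMM'
    · intro G hG
      rw [Nat.cast_succ, add_mul, one_mul]
      -- If `G` has a point `g ≤ M`, then beyond it `G` is covered by at most `M` sets of complexity
      -- `R`, each of weight at most `δ / (M + 1)` on the new average. Otherwise the empty cover
      -- shows that the old weight is nonpositive.
      by_cases hmeet : ∃ g ∈ G, N < (g : ℕ) ∧ (g : ℕ) ≤ M
      · obtain ⟨g, hg, -, hgM⟩ := hmeet
        obtain ⟨l, hl, hlR, hcover⟩ := hG g hg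
        have h1 : μ' G ≤ (l.map μ').sum := hμ'.cover G l fun x hx hMx _ =>
          hcover x hx (by rw [← PNat.coe_lt_coe]; omega)
        have h2 : (l.map μ').sum ≤ l.length * δ' := by
          have := List.sum_le_card_nsmul (l.map μ') δ' fun a ha => by
            obtain ⟨A, hA, rfl⟩ := List.mem_map.mp ha
            exact hcov' A (hlR A hA)
          rwa [List.length_map, nsmul_eq_mul] at this
        have h3 : (l.length : ℝ) * δ' ≤ M * δ' :=
          mul_le_mul_of_nonneg_right (by exact_mod_cast hl.trans hgM) hδ'0.le
        have h4 := hcov G hG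
        linarith
      · have h1 : μ G ≤ 0 := by
          have := hμ.cover G [] fun g hg h1 h2 => absurd ⟨g, hg, h1, h2⟩ hmeet
          simpa using this
        have h2 := hμ'.le G
        have h3 : 0 ≤ (n : ℝ) * δ := by positivity
        linarith

theorem HasAverages.succ {T : Set (List D.Space)} (hT : IsSeqTree T) {ε C κ : ℝ} {R : ℕ}
    (h : D.HasAverages T ε C κ R) : D.HasAverages T ε C κ (R + 1) := by
  intro γ s N δ hδ hδ1 hs
  -- With the parameter `δ / 2` the average has weight at most `(1 + n δ / 2) / n ≤ δ`.
  obtain ⟨n, hn⟩ := exists_nat_gt (2 / δ)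
  have hn0 : (0 : ℝ) < n := (by positivity : (0 : ℝ) < 2 / δ).trans hn
  have hs' : s ∈ iterDerivedTree T (γ + ω ^ ((R : Ordinal.{0}) + 1) * n) := by
    refine hT.antitone_iterDerivedTree (add_le_add_right ?_ γ) hs
    rw [Nat.cast_succ, Ordinal.opow_add_one ω ((R : Ordinal.{0}) + 1)]
    exact mul_le_mul_right (Ordinal.natCast_lt_omega0 n).le _
  obtain ⟨u, v, M, y, μ, hsu, hv, hNM, hvy, hμ, hcov⟩ :=
    h.exists_sum n γ s N (half_pos hδ) (by linarith) hs'
  have hn' : (0 : ℝ) ≤ (n : ℝ)⁻¹ := by positivity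
  refine ⟨u, (n : ℝ)⁻¹ • v, M, (n : ℝ)⁻¹ • y, fun G => (n : ℝ)⁻¹ * μ G, hsu, ?_, hNM, ?_, ?_, ?_⟩
  · have := hv.smul hn'
    rwa [inv_mul_cancel₀ hn0.ne'] at this
  · rw [map_smul, ← smul_sub, norm_smul, Real.norm_of_nonneg hn', inv_mul_le_iff₀ hn0]
    refine hvy.trans (mul_le_mul_of_nonneg_left (by linarith) hn0.le)
  · have := hμ.smul hn'
    rwa [inv_mul_cancel₀ hn0.ne'] at this
  · intro G hG
    rw [inv_mul_le_iff₀ hn0]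
    refine (hcov G hG).trans ?_
    rw [div_lt_iff₀ hδ] at hn
    linarith

theorem hasAverages {T : Set (List D.Space)} (hT : IsSeqTree T)
    (hT1 : ∀ s ∈ T, ∀ x ∈ s, ‖x‖ = 1) {p : ℕ+} (hp : D.σ p = TsirelsonMode.M) {ε C : ℝ}
    (hε : 0 ≤ ε) (hC : 0 ≤ C) (R : ℕ) : D.HasAverages T ε C (2 * ε * (D.θ p)⁻¹) R := by
  induction R with
  | zero => exact hasAverages_zero hT hT1 hp hε hC
  | succ R ih => exact ih.succ hT

theorem exists_uniform_bound (D : TsirelsonData) (q : ℕ+) :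
    ∃ t : ℝ, 0 ≤ t ∧ t < 1 ∧ ∀ n : ℕ+, n ≤ q → D.θ n ≤ t := by
  obtain ⟨n, -, hn⟩ := Finset.exists_max_image (Finset.Icc 1 q) D.θ ⟨1, by simp⟩
  exact ⟨D.θ n, (D.θ_mem n).1.le, (D.θ_mem n).2, fun k hk => hn k (by simp [hk])⟩

theorem exists_eta_lt
    (hη : ⨅ m : ℕ+, limsup (fun n : ℕ+ => D.eta m n) atTop = 0) {ε : ℝ} (hε : 0 < ε) :
    ∃ m N : ℕ+, ∀ n, N ≤ n → D.eta m n < ε := by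
  obtain ⟨m, hm⟩ := exists_lt_of_ciInf_lt (hη.trans_lt hε)
  have hb : IsBoundedUnder (· ≤ ·) atTop fun n : ℕ+ => D.eta m n :=
    isBoundedUnder_of ⟨1, fun n => (D.eta_mem_Icc m n).2⟩
  obtain ⟨N, hN⟩ := eventually_atTop.mp (eventually_lt_of_limsup_lt hm hb)
  exact ⟨m, N, hN⟩

/-- All `ℓ¹`-trees have orders at most `ω ^ ω`. -/
theorem iterDerivedTree_eq_empty
    (hη : ⨅ m : ℕ+, limsup (fun n : ℕ+ => D.eta m n) atTop = 0) {K : ℝ} (hK : 0 < K)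
    {T : Set (List D.Space)} (hT : IsEllOneTree D.Space K T) :
    iterDerivedTree T (ω ^ ω) = ∅ := by
  rw [Set.eq_empty_iff_forall_notMem]
  intro s hs
  obtain ⟨p, hp⟩ := D.exists_modified
  have hθ := (D.θ_mem p).1
  -- Of the lower bound `1 / K = 4 / (4 K)`, the terms `2 ε / θ_p`, `(2 C + 1) δ` and `τ` use up at
  -- most `1 / (4 K)` each.
  set ε := min 1 (D.θ p / (8 * K)) with hεdef
  have hε0 : 0 < ε := lt_min one_pos (by positivity)
  obtain ⟨m, N, hmN⟩ := exists_eta_lt hη hε0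
  obtain ⟨t, ht0, ht1, ht⟩ := D.exists_uniform_bound (m + N)
  obtain ⟨L, hL⟩ := exists_pow_lt_of_lt_one hε0 ht1
  have hmax : max (t ^ L) ε = ε := max_eq_right hL.le
  set C := (D.θ p)⁻¹ ^ (m : ℕ) with hCdef
  have hC : 0 ≤ C := by positivity
  set δ := min 1 (1 / (4 * K * (2 * C + 1))) with hδdef
  have hδ0 : 0 < δ := lt_min one_pos (by positivity)
  set R := L * (m + N : ℕ+) + 1 with hR
  have hs' : s ∈ iterDerivedTree T (0 + ω ^ ((R : Ordinal.{0}) + 1)) := by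
    refine hT.1.antitone_iterDerivedTree ?_ hs
    rw [zero_add]
    refine Ordinal.opow_le_opow_right Ordinal.omega0_pos ?_
    exact_mod_cast (Ordinal.natCast_lt_omega0 (R + 1)).le
  obtain ⟨u, v, M, y, μ, hsu, hv, -, hvy, hμ, hcov⟩ :=
    hasAverages hT.1 (fun s hs => (hT.2 s hs).1) hp hε0.le hC R 0 s 0 δ hδ0 (min_le_left _ _) hs'
  rw [iterDerivedTree_zero] at hsu
  have hv1 : IsCombination (s ++ u) v 1 := by
    simpa using (isCombination_zero s).append hv
  have hlow := hT.le_norm hsu hv1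
  have hτ : 0 < 1 / (4 * K) := by positivity
  obtain ⟨ι, _, F, f, w, hw, -, hG, hle⟩ := hasSystem hp ht0 hε0.le (min_le_left _ _)
    (q := (m + N : ℕ+)) (m := m) (by rw [PNat.add_coe]; omega) (fun n hn => ht n hn)
    (fun n hn => hmN n (by
      rw [PNat.add_coe] at hn
      rw [← PNat.coe_le_coe]
      omega)) L univ y hτ
  rw [hmax] at hw
  rw [restrictTo_univ, ← norm_embed] at hle
  have h1 := hμ.sum_le ι F f w hw
  have h2 := hcov _ hG
  have h3 : ‖v‖ ≤ ‖D.embed y‖ + δ := by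
    have := norm_sub_norm_le v (D.embed y)
    linarith
  have h4 : 2 * ε * (D.θ p)⁻¹ ≤ 1 / (4 * K) := by
    have h : ε ≤ D.θ p / (8 * K) := min_le_right _ _
    rw [← div_eq_mul_inv, div_le_iff₀ hθ]
    calc 2 * ε ≤ 2 * (D.θ p / (8 * K)) := by linarith
      _ = 1 / (4 * K) * D.θ p := by field_simp; norm_num
  have h5 : (2 * C + 1) * δ ≤ 1 / (4 * K) := by
    have h : δ ≤ 1 / (4 * K * (2 * C + 1)) := min_le_right _ _
    calc (2 * C + 1) * δ ≤ (2 * C + 1) * (1 / (4 * K * (2 * C + 1))) :=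
          mul_le_mul_of_nonneg_left h (by positivity)
      _ = 1 / (4 * K) := by field_simp
  have h6 : 2 * C * μ (Finset.univ.image f) ≤ 2 * C * δ :=
    mul_le_mul_of_nonneg_left h2 (by positivity)
  have h7 : K⁻¹ = 4 * (1 / (4 * K)) := by field_simp
  rw [mul_one] at hlow h1
  linarith

end TsirelsonData

/-! ### Trees of large order -/

/-- Concatenations of `k` lists that enumerate successive sets in `S_n`, beyond `N`. -/
def schreierChains (n : ℕ) : ℕ → ℕ → Set (List ℕ+)
  | 0, _ => {[]}
  | k + 1, N => {L | ∃ (L₁ L₂ : List ℕ+) (N' : ℕ), L = L₁ ++ L₂ ∧ L₁.Nodup ∧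
      L₁.toFinset ∈ schreier n ∧ N ≤ N' ∧ (∀ a ∈ L₁, N < (a : ℕ) ∧ (a : ℕ) ≤ N') ∧
      L₂ ∈ schreierChains n k N'}

theorem nodup_of_mem_schreierChains {n k N : ℕ} {L : List ℕ+} (hL : L ∈ schreierChains n k N) :
    L.Nodup ∧ ∀ a ∈ L, N < (a : ℕ) := by
  induction k generalizing N L with
  | zero => rw [show L = [] from hL]; simp
  | succ k ih =>
    obtain ⟨L₁, L₂, N', rfl, h1, -, hN, hL₁, hL₂⟩ := hL
    obtain ⟨h3, h4⟩ := ih hL₂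
    refine ⟨List.nodup_append.mpr ⟨h1, h3, ?_⟩, fun a ha => ?_⟩
    · rintro a ha b hb rfl
      have := hL₁ a ha
      have := h4 a hb
      omega
    · rcases List.mem_append.mp ha with h | h
      · exact (hL₁ a h).1
      · exact hN.trans_lt (h4 a h)

theorem exists_decomposition_of_mem_schreierChains {n k N : ℕ} {L : List ℕ+}
    (hL : L ∈ schreierChains n k N) :
    ∃ (B : Finset ℕ+) (H : ℕ+ → Finset ℕ+), B.card ≤ k ∧ (∀ b ∈ B, N < (b : ℕ)) ∧
      (∀ b ∈ B, H b ∈ schreier n) ∧ (∀ b ∈ B, IsLeast (H b : Set ℕ+) b) ∧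
      (∀ b ∈ B, ∀ c ∈ B, b < c → ∀ x ∈ H b, ∀ y ∈ H c, x < y) ∧
      L.toFinset = B.biUnion H := by
  induction k generalizing N L with
  | zero =>
    rw [show L = [] from hL]
    exact ⟨∅, fun _ => ∅, by simp⟩
  | succ k ih =>
    obtain ⟨L₁, L₂, N', rfl, h1, hS, hN, hL₁, hL₂⟩ := hL
    obtain ⟨B, H, hcard, hB, hH, hl, hlt, heq⟩ := ih hL₂
    rcases L₁.toFinset.eq_empty_or_nonempty with he | hne
    · refine ⟨B, H, hcard.trans k.le_succ, fun b hb => hN.trans_lt (hB b hb), hH, hl, hlt, ?_⟩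
      rw [List.toFinset_append, he, Finset.empty_union, heq]
    · obtain ⟨b₁, hb₁⟩ : ∃ b, IsLeast (L₁.toFinset : Set ℕ+) b :=
        ⟨_, L₁.toFinset.isLeast_min' hne⟩
      have hb₁N := hL₁ b₁ (List.mem_toFinset.mp hb₁.1)
      obtain ⟨H', hHb, hHb₁⟩ : ∃ H' : ℕ+ → Finset ℕ+,
          (∀ b ∈ B, H' b = H b) ∧ H' b₁ = L₁.toFinset :=
        ⟨Function.update H b₁ L₁.toFinset, fun b hb => Function.update_of_ne
          (by rintro rfl; exact (hB b hb).not_ge hb₁N.2) _ _, Function.update_self _ _ _⟩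
      refine ⟨insert b₁ B, H',
        (Finset.card_insert_le _ _).trans (Nat.succ_le_succ hcard), ?_, ?_, ?_, ?_, ?_⟩
      · intro b hb
        rcases Finset.mem_insert.mp hb with h | h
        · rw [h]; exact hb₁N.1
        · exact hN.trans_lt (hB b h)
      · intro b hb
        rcases Finset.mem_insert.mp hb with h | h
        · rw [h, hHb₁]; exact hS
        · rw [hHb b h]; exact hH b h
      · intro b hb
        rcases Finset.mem_insert.mp hb with h | h
        · rw [h, hHb₁]; exact hb₁
        · rw [hHb b h]; exact hl b h
      · intro b hb c hc hbc x hx y hy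
        rcases Finset.mem_insert.mp hc with h | h
        · rcases Finset.mem_insert.mp hb with h' | h'
          · exact absurd hbc (by rw [h, h']; exact lt_irrefl _)
          · have h2 := hB b h'
            have h3 : (b : ℕ) < c := hbc
            rw [h] at h3
            omega
        · rw [hHb c h] at hy
          rcases Finset.mem_insert.mp hb with h' | h'
          · rw [h', hHb₁] at hx
            have h3 := (hL₁ x (List.mem_toFinset.mp hx)).2
            have h4 := hB c h
            have h5 : (c : ℕ) ≤ y := (hl c h).2 hy
            rw [← PNat.coe_lt_coe]
            omega
          · rw [hHb b h'] at hx
            exact hlt b h' c h hbc x hx y hy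
      · rw [List.toFinset_append, Finset.biUnion_insert, hHb₁, heq]
        congr 1
        exact Finset.biUnion_congr rfl fun b hb => (hHb b hb).symm

/-- There are at most `k ≤ N` nonempty blocks and their minima exceed `N`, so the minima form an
`S_1`-set. -/
theorem toFinset_mem_schreier_succ {n k N : ℕ} {L : List ℕ+} (hL : L ∈ schreierChains n k N)
    (hk : k ≤ N) : L.toFinset ∈ schreier (n + 1) := by
  obtain ⟨B, H, hcard, hB, hH, hl, hlt, heq⟩ := exists_decomposition_of_mem_schreierChains hL
  rw [schreier_succ]
  exact ⟨B, fun b hb => hcard.trans (hk.trans (hB b hb).le), H, hH, hl, hlt, heq⟩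

section Rank

variable {B : Type u} {T : Set (List B)}

theorem mem_iterDerivedTree_of_chains {n : ℕ} (e : ℕ+ → B)
    (hn : ∀ (γ : Ordinal.{u}) (s : List B) (N : ℕ), s ≠ [] →
      (∀ L : List ℕ+, L.Nodup → L.toFinset ∈ schreier n → (∀ a ∈ L, N < (a : ℕ)) →
        s ++ L.map e ∈ iterDerivedTree T γ) → s ∈ iterDerivedTree T (γ + ω ^ (n : Ordinal.{u})))
    (k : ℕ) (γ : Ordinal.{u}) {s : List B} (N : ℕ) (hs : s ≠ [])
    (h : ∀ L ∈ schreierChains n k N, s ++ L.map e ∈ iterDerivedTree T γ) :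
    s ∈ iterDerivedTree T (γ + ω ^ (n : Ordinal.{u}) * k) := by
  induction k generalizing s N with
  | zero => simpa using h [] rfl
  | succ k ih =>
    rw [Nat.cast_succ, mul_add, mul_one, ← add_assoc]
    refine hn _ s N hs fun L₁ hL₁ hS hN => ?_
    refine ih (max N (L₁.toFinset.sup fun a => (a : ℕ))) (by simp [hs]) fun L₂ hL₂ => ?_
    have := h (L₁ ++ L₂) ⟨L₁, L₂, _, rfl, hL₁, hS, le_max_left _ _, fun a ha => ⟨hN a ha,
      le_max_of_le_right (Finset.le_sup (f := fun a : ℕ+ => (a : ℕ))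
        (List.mem_toFinset.mpr ha))⟩, hL₂⟩
    rwa [List.map_append, ← List.append_assoc] at this

/-- Enumerating sets of `S_n` beyond any fixed point costs at least `ω ^ n` derivatives. Since `ω ^
(n + 1)` is the limit of `ω ^ n * k`, it suffices to use `k` consecutive `S_n`-sets, which together
form an `S_{n+1}`-set once they lie beyond `k`. -/
theorem mem_iterDerivedTree_of_schreier (hT : IsSeqTree T) (e : ℕ+ → B) (n : ℕ)
    (γ : Ordinal.{u}) (s : List B) (N : ℕ) (hs : s ≠ [])
    (h : ∀ L : List ℕ+, L.Nodup → L.toFinset ∈ schreier n → (∀ a ∈ L, N < (a : ℕ)) →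
      s ++ L.map e ∈ iterDerivedTree T γ) :
    s ∈ iterDerivedTree T (γ + ω ^ (n : Ordinal.{u})) := by
  induction n generalizing γ s N with
  | zero =>
    rw [Nat.cast_zero, Ordinal.opow_zero, iterDerivedTree_add_one]
    refine ⟨hs, e (Nat.succPNat N), ?_⟩
    exact h [Nat.succPNat N] (by simp) (by simp [schreier]) (by simp)
  | succ n ih =>
    have hlim : Order.IsSuccLimit (ω ^ ((n + 1 : ℕ) : Ordinal.{u})) :=
      Ordinal.isSuccLimit_opow_left Ordinal.isSuccLimit_omega0 (by simp)
    rw [mem_iterDerivedTree_limit (Ordinal.isSuccLimit_add γ hlim)]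
    intro δ hδ
    obtain ⟨c, hc, hδc⟩ := (Ordinal.lt_add_iff_of_isSuccLimit hlim).mp hδ
    rw [Nat.cast_succ, Ordinal.opow_add_one,
      Ordinal.lt_mul_iff_of_isSuccLimit Ordinal.isSuccLimit_omega0] at hc
    obtain ⟨b, hb, hcb⟩ := hc
    obtain ⟨k, rfl⟩ := Ordinal.lt_omega0.mp hb
    refine hT.antitone_iterDerivedTree (hδc.le.trans (add_le_add_right hcb.le γ)) ?_
    refine mem_iterDerivedTree_of_chains e ih k γ (max N k) hs fun L hL => ?_
    obtain ⟨h1, h2⟩ := nodup_of_mem_schreierChains hL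
    exact h L h1 (toFinset_mem_schreier_succ hL (le_max_right _ _))
      fun a ha => (le_max_left _ _).trans_lt (h2 a ha)

/-- An empty derivative must exist: otherwise the infimum defining the order is over the empty set
and equals `0`. -/
theorem lt_treeOrder (hT : IsSeqTree T) {α β : Ordinal.{u}}
    (hα : (iterDerivedTree T α).Nonempty) (hβ : iterDerivedTree T β = ∅) : α < treeOrder T := by
  have h : iterDerivedTree T (treeOrder T) = ∅ :=
    csInf_mem (s := {α | iterDerivedTree T α = ∅}) ⟨β, hβ⟩
  by_contra hn
  obtain ⟨s, hs⟩ := hα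
  have := hT.antitone_iterDerivedTree (not_lt.mp hn) hs
  rw [h] at this
  exact this

end Rank

/-! ### Schreier trees of unit vectors. -/

namespace TsirelsonData

variable (D : TsirelsonData)

/-- The unit vectors. -/
noncomputable def unitVector (k : ℕ+) : D.Space := D.embed (Finsupp.single k 1)

theorem norm_unitVector (k : ℕ+) : ‖D.unitVector k‖ = 1 := by
  rw [unitVector, norm_embed]
  refine le_antisymm ((D.isIntermediateNorm_tnorm.le_lone _).trans ?_) ?_
  · rw [loneNorm, Finsupp.support_single k one_ne_zero]
    simp
  · refine le_trans ?_ (D.isIntermediateNorm_tnorm.czero_le _)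
    simpa using abs_le_czeroNorm (Finsupp.single k (1 : ℝ)) k

/-- The lists of unit vectors with indices in a set of the family `S_n`. -/
def schreierTree (n : ℕ) : Set (List D.Space) :=
  {s | ∃ L : List ℕ+, L ≠ [] ∧ L.Nodup ∧ (∃ A ∈ schreier n, ∀ k ∈ L, k ∈ A) ∧
    s = L.map D.unitVector}

/-- Singletons `{k}` with `k ∈ A ∈ S_n` are adapted in both modes, so `θ_n ∑ |x k| ≤ ‖x‖`. Only
containment of the indices in `A` is required, which makes the closure under initial segments
immediate. -/
theorem isEllOneTree_schreierTree (n : ℕ+) :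
    IsEllOneTree D.Space (D.θ n)⁻¹ (D.schreierTree n) := by
  classical
  refine ⟨⟨?_, ?_⟩, ?_⟩
  · rintro s ⟨L, hL, -, -, rfl⟩
    simpa using hL
  · rintro s x hs ⟨L, hL, hnd, ⟨A, hA, hLA⟩, heq⟩
    obtain ⟨L₁, L₂, rfl, h1, h2⟩ := List.map_eq_append_iff.mp heq.symm
    refine ⟨L₁, ?_, (List.nodup_append.mp hnd).1,
      ⟨A, hA, fun k hk => hLA k (List.mem_append_left _ hk)⟩, h1.symm⟩
    rintro rfl
    exact hs h1.symm
  · rintro s ⟨L, hL, hnd, ⟨A, hA, hLA⟩, rfl⟩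
    refine ⟨fun x hx => ?_, fun a => ?_⟩
    · obtain ⟨k, -, rfl⟩ := List.mem_map.mp hx
      exact D.norm_unitVector k
    · have hlen : ∀ i : Fin (L.map D.unitVector).length, (i : ℕ) < L.length := fun i => by
        simpa using i.2
      set κ : Fin (L.map D.unitVector).length → ℕ+ := fun i => L.get ⟨i, hlen i⟩ with hκ
      have hκinj : Function.Injective κ := fun i j hij => by
        have := (List.nodup_iff_injective_get.mp hnd) hij
        exact Fin.ext (by simpa using this)
      set x : ℕ+ →₀ ℝ := ∑ i, a i • Finsupp.single (κ i) 1 with hx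
      have hsum : ∑ i, a i • (L.map D.unitVector).get i = D.embed x := by
        rw [hx, map_sum]
        refine Finset.sum_congr rfl fun i _ => ?_
        rw [map_smul]
        simp [hκ, unitVector]
      have hxκ : ∀ i, x (κ i) = a i := by
        intro i
        rw [hx, Finsupp.finsetSum_apply, Finset.sum_eq_single i]
        · simp
        · intro j _ hj
          simp [hκinj.ne hj]
        · simp
      rw [inv_inv, hsum, norm_embed]
      have hle := D.mul_sum_tnorm_le (J := A) (E := fun k => {k}) (m := id) (n := n)
        (fun k _ => isLeast_singleton) (by rwa [Finset.image_id]) ⟨?_, ?_⟩ x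
      · refine le_trans (mul_le_mul_of_nonneg_left ?_ (D.θ_mem n).1.le) hle
        calc ∑ i, |a i| = ∑ i, |x (κ i)| := by simp_rw [hxκ]
          _ = ∑ k ∈ Finset.univ.image κ, |x k| := by
              rw [Finset.sum_image fun i _ j _ h => hκinj h]
          _ ≤ ∑ k ∈ A, |x k| := by
              refine Finset.sum_le_sum_of_subset_of_nonneg ?_ fun _ _ _ => abs_nonneg _
              intro k hk
              obtain ⟨i, -, rfl⟩ := Finset.mem_image.mp hk
              exact hLA _ (List.get_mem _ _)
          _ ≤ _ := by
              refine Finset.sum_le_sum fun k _ => ?_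
              rw [← restrictTo_apply_of_mem (Set.mem_singleton k) x]
              exact (abs_le_czeroNorm _ k).trans (D.isIntermediateNorm_tnorm.czero_le _)
      · intro i _ j _ hij
        simpa using hij
      · rintro - i - j - hij a rfl b rfl
        exact hij

theorem nonempty_iterDerivedTree_schreierTree (n : ℕ) :
    (iterDerivedTree (D.schreierTree (n + 1)) (ω ^ (n : Ordinal.{0}))).Nonempty := by
  have hT : IsSeqTree (D.schreierTree (n + 1)) :=
    (D.isEllOneTree_schreierTree (Nat.succPNat n)).1
  refine ⟨[D.unitVector 3], ?_⟩
  rw [← zero_add (ω ^ (n : Ordinal.{0}))]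
  refine mem_iterDerivedTree_of_schreier hT D.unitVector n 0 _ 3 (by simp) fun L hL hS h3 => ?_
  rw [iterDerivedTree_zero]
  -- Derived trees contain nonempty lists only, so the root is `[e₃]`. It costs one extra `S_n`-set:
  -- `{3}` and `L` are two successive sets beyond `2`, hence form an `S_{n+1}`-set.
  have hchain : 3 :: L ∈ schreierChains n 2 2 := by
    refine ⟨[3], L, 3, rfl, by simp, ?_, by norm_num, by simp, L, [], max 3
      (L.toFinset.sup fun a => (a : ℕ)), by simp, hL, hS, le_max_left _ _, fun a ha => ⟨h3 a ha,
        le_max_of_le_right (Finset.le_sup (f := fun a : ℕ+ => (a : ℕ))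
          (List.mem_toFinset.mpr ha))⟩, rfl⟩
    exact schreier_mono (Nat.zero_le n) (by simp [schreier])
  exact ⟨3 :: L, by simp, (nodup_of_mem_schreierChains hchain).1,
    ⟨_, toFinset_mem_schreier_succ hchain le_rfl, fun k hk => List.mem_toFinset.mpr hk⟩, rfl⟩

end TsirelsonData

/-! ### Copies of `ℓ¹` -/

section EllOne

variable {B : Type u}

/-- The nonempty initial segments of a sequence. -/
def initialSegments (x : ℕ → B) : Set (List B) := {s | ∃ n, s = (List.range (n + 1)).map x}

theorem isSeqTree_initialSegments (x : ℕ → B) : IsSeqTree (initialSegments x) := by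
  refine ⟨?_, ?_⟩
  · rintro s ⟨n, rfl⟩
    simp
  · rintro s y hs ⟨n, heq⟩
    rw [List.range_succ, List.map_append] at heq
    have h1 := (List.append_inj' heq rfl).1
    cases n with
    | zero => exact absurd h1 (by simpa using hs)
    | succ n => exact ⟨n, h1⟩

theorem iterDerivedTree_initialSegments (x : ℕ → B) (α : Ordinal.{u}) :
    iterDerivedTree (initialSegments x) α = initialSegments x := by
  have hT := isSeqTree_initialSegments x
  induction α using Ordinal.limitRecOn with
  | zero => exact iterDerivedTree_zero _
  | add_one α ih =>
    rw [iterDerivedTree_add_one, ih]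
    refine Set.Subset.antisymm ?_ ?_
    · rintro s ⟨hs, y, hy⟩
      exact hT.of_append s y hs hy
    · rintro s ⟨n, rfl⟩
      exact ⟨by simp, x (n + 1), n + 1, by rw [List.range_succ (n := n + 1), List.map_append]; rfl⟩
  | limit β hβ ih =>
    ext s
    rw [mem_iterDerivedTree_limit hβ]
    constructor
    · intro h
      rw [← ih 0 hβ.bot_lt]
      exact h 0 hβ.bot_lt
    · intro h γ hγ
      rwa [ih γ hγ]

variable [NormedAddCommGroup B] [NormedSpace ℝ B]

/-- Normalizing the images of the unit vectors of ℓ¹ divides the coefficients by at most `‖f‖`,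
whence the constant `‖f‖ / c`. -/
theorem ContainsEllOne.exists_sequence (h : ContainsEllOne B) :
    ∃ (x : ℕ → B) (K : ℝ), 0 < K ∧ IsEllOneTree B K (initialSegments x) := by
  obtain ⟨f, c, hc, hf⟩ := h
  set g : ℕ → B := fun i => f (lp.single 1 i (1 : ℝ)) with hg
  have hsingle : ∀ i : ℕ, ‖lp.single (E := fun _ : ℕ => ℝ) 1 i (1 : ℝ)‖ = 1 := fun i => by
    rw [lp.norm_single one_pos, norm_one]
  have hgc : ∀ i, c ≤ ‖g i‖ := fun i => by simpa [hsingle i] using hf (lp.single 1 i (1 : ℝ))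
  have hgf : ∀ i, ‖g i‖ ≤ ‖f‖ := fun i => by
    simpa [hsingle i] using f.le_opNorm (lp.single 1 i (1 : ℝ))
  have hg0 : ∀ i, 0 < ‖g i‖ := fun i => hc.trans_le (hgc i)
  have hf0 : 0 < ‖f‖ := (hg0 0).trans_le (hgf 0)
  refine ⟨fun i => ‖g i‖⁻¹ • g i, ‖f‖ / c, by positivity, isSeqTree_initialSegments _, ?_⟩
  rintro _ ⟨n, rfl⟩
  set s := (List.range (n + 1)).map fun i => ‖g i‖⁻¹ • g i with hs
  refine ⟨fun x hx => ?_, fun a => ?_⟩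
  · obtain ⟨i, -, rfl⟩ := List.mem_map.mp hx
    rw [norm_smul, norm_inv, norm_norm, inv_mul_cancel₀ (hg0 i).ne']
  · set b : ℕ → ℝ := fun i => if h : i < s.length then a ⟨i, h⟩ * ‖g i‖⁻¹ else 0 with hb
    have hbi : ∀ i : Fin s.length, b i = a i * ‖g i‖⁻¹ := fun i => dif_pos i.2
    set z := ∑ i ∈ Finset.range s.length, lp.single (E := fun _ : ℕ => ℝ) 1 i (b i) with hz
    have hnorm : ‖z‖ = ∑ i : Fin s.length, |a i| * ‖g i‖⁻¹ := by
      have h1 := lp.norm_sum_single (E := fun _ : ℕ => ℝ) (p := 1) (by norm_num) b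
        (Finset.range s.length)
      simp only [ENNReal.toReal_one, Real.rpow_one] at h1
      rw [hz, h1, Finset.sum_range]
      refine Finset.sum_congr rfl fun i _ => ?_
      rw [hbi, norm_mul, norm_inv, norm_norm, Real.norm_eq_abs]
    have hfz : f z = ∑ i : Fin s.length,
        a i • s.get i := by
      rw [hz, map_sum, Finset.sum_range]
      refine Finset.sum_congr rfl fun i _ => ?_
      have h1 : lp.single (E := fun _ : ℕ => ℝ) 1 (i : ℕ) (b i) =
          b i • lp.single (E := fun _ : ℕ => ℝ) 1 (i : ℕ) (1 : ℝ) := by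
        rw [← lp.single_smul, smul_eq_mul, mul_one]
      rw [h1, map_smul, hbi, mul_smul]
      simp [hs, hg]
    rw [← hfz]
    refine le_trans ?_ (hf z)
    rw [hnorm, inv_div, div_mul_eq_mul_div, mul_div_assoc, Finset.sum_div]
    refine mul_le_mul_of_nonneg_left (Finset.sum_le_sum fun i _ => ?_) hc.le
    rw [div_eq_mul_inv]
    exact mul_le_mul_of_nonneg_left (inv_anti₀ (hg0 i) (hgf i)) (abs_nonneg _)

end EllOne

/-! ### The theorem. -/

theorem mainTheorem4 (D : TsirelsonData)
    (hη : ⨅ m : ℕ+, limsup (fun n : ℕ+ => D.eta m n) atTop = 0) :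
    ¬ ContainsEllOne D.Space ∧ bourgainIndex D.Space = ω ^ ω := by
  have hupper : ∀ K : ℝ, 1 ≤ K → ∀ T : Set (List D.Space), IsEllOneTree D.Space K T →
      treeOrder T ≤ ω ^ ω := fun K hK T hT =>
    csInf_le' (TsirelsonData.iterDerivedTree_eq_empty hη (one_pos.trans_le hK) hT)
  -- Besides the upper estimate, these bounds ensure that the suprema below are over bounded sets.
  have hbdd : ∀ K : ℝ, 1 ≤ K →
      ω ^ ω ∈ upperBounds {o | ∃ T : Set (List D.Space), IsEllOneTree D.Space K T ∧
        o = treeOrder T} := by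
    rintro K hK _ ⟨T, hT, rfl⟩
    exact hupper K hK T hT
  have hbdd' : ω ^ ω ∈ upperBounds {o | ∃ K : ℝ, 1 ≤ K ∧ o = bourgainIndexAt D.Space K} := by
    rintro _ ⟨K, hK, rfl⟩
    exact csSup_le' (hbdd K hK)
  refine ⟨fun h => ?_, le_antisymm (csSup_le' hbdd') ?_⟩
  · obtain ⟨x, K, hK, hT⟩ := h.exists_sequence
    have h1 := TsirelsonData.iterDerivedTree_eq_empty hη hK hT
    rw [iterDerivedTree_initialSegments] at h1
    have h2 : (List.range 1).map x ∈ initialSegments x := ⟨0, rfl⟩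
    rw [h1] at h2
    exact h2
  · rw [Ordinal.opow_le_of_isSuccLimit Ordinal.omega0_ne_zero Ordinal.isSuccLimit_omega0]
    intro b hb
    obtain ⟨n, rfl⟩ := Ordinal.lt_omega0.mp hb
    have hT := D.isEllOneTree_schreierTree (Nat.succPNat n)
    have hθ := D.θ_mem (Nat.succPNat n)
    have hK : 1 ≤ (D.θ (Nat.succPNat n))⁻¹ := (one_le_inv₀ hθ.1).mpr hθ.2.le
    have h1 : ω ^ (n : Ordinal.{0}) < treeOrder (D.schreierTree (n + 1)) :=
      lt_treeOrder hT.1 (D.nonempty_iterDerivedTree_schreierTree n)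
        (TsirelsonData.iterDerivedTree_eq_empty hη (one_pos.trans_le hK) hT)
    have h2 : treeOrder (D.schreierTree (n + 1)) ≤
        bourgainIndexAt D.Space (D.θ (Nat.succPNat n))⁻¹ :=
      le_csSup ⟨_, hbdd _ hK⟩ ⟨_, hT, rfl⟩
    exact h1.le.trans (h2.trans (le_csSup ⟨_, hbdd'⟩ ⟨_, hK, rfl⟩))
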